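/- Let $\mathbb{B}^3\subset\mathbb{R}^3$ be the closed unit ball and $\mathbb{S}^2$ its boundary sphere. Let $W\subset\mathbb{B}^3$ be a connected closed region (a nonempty connected set that is the closure of its interior), and let $\partial W$ denote the closure of the part of the topological boundary of $W$ that lies in the open unit ball. Suppose that $\partial W$ is a smooth surface (smooth up to its boundary), that $\partial W$ meets $\mathbb{S}^2$ orthogonally and exactly along the boundary of the surface $\partial W$, and that $\partial W$ is (non-strictly) mean convex, i.e. its mean curvature with respect to the unit normal pointing into $W$ is nonnegative. Suppose that $W$ contains a closed half-disk $D^+$, i.e. one of the two closed halves into which a diameter of $\mathbb{B}^3$ divides the intersection of $\mathbb{B}^3$ with a plane through the origin, and let $p$ be one of the two corners of $D^+$ (the endpoints of that diameter). If $\partial W$ is tangent to $D^+$ at $p$ (that is, $p\in\partial W$ and the tangent plane of $\partial W$ at $p$ is the plane containing $D^+$), then $W$ is a closed halfball, i.e. $W=\{x\in\mathbb{B}^3 : \langle x,v\rangle\ge 0\}$ for some unit vector $v$. -/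

import Mathlib

open Set Metric
open scoped ContDiff RealInnerProductSpace

noncomputable section

namespace FreeBoundary

/-- Euclidean three-space. The unit ball `𝔹³` is `closedBall 0 1`, the sphere `𝕊²` is
`sphere 0 1`. -/
abbrev E3 : Type := EuclideanSpace ℝ (Fin 3)

/-- For a region `W` in the unit ball, the surface written `∂W`: the closure of the part of the
topological boundary of `W` that lies in the open unit ball. -/
def bdry (W : Set E3) : Set E3 :=
  closure (frontier W ∩ ball 0 1)

/-- A connected closed region of the unit ball: a nonempty connected subset of the closed ball
which is the closure of its interior. -/
structure IsClosedRegion (W : Set E3) : Prop where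
  subset_ball : W ⊆ closedBall 0 1
  connected : IsConnected W
  closure_interior : closure (interior W) = W

/-- `ρ` is a smooth defining function of `W` (relative to the unit ball) on the open set `U`:
`∇ρ` has no zero in `U`, and in `U` the region `W` is the part of the ball where `ρ ≥ 0`. -/
structure IsDefiningFunction (W U : Set E3) (ρ : E3 → ℝ) : Prop where
  isOpen : IsOpen U
  smooth : ContDiffOn ℝ ∞ ρ U
  gradient_ne_zero : ∀ x ∈ U, gradient ρ x ≠ 0
  inter_eq : W ∩ U = {x | x ∈ U ∧ x ∈ closedBall (0 : E3) 1 ∧ 0 ≤ ρ x}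

/-- `∂W` is smooth (up to and including its points on the sphere): near each of its points,
`W` is given by a smooth defining function. -/
def HasSmoothBdry (W : Set E3) : Prop :=
  ∀ q ∈ bdry W, ∃ (U : Set E3) (ρ : E3 → ℝ), q ∈ U ∧ IsDefiningFunction W U ρ

/-- The unit normal field `∇ρ / |∇ρ|` of the level sets of `ρ`. For a defining function of `W`
it points into `W` along `∂W`. -/
def unitNormal (ρ : E3 → ℝ) (x : E3) : E3 :=
  ‖gradient ρ x‖⁻¹ • gradient ρ x

/-- The mean curvature (half the sum of the principal curvatures) at `x` of the level set of `ρ`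
through `x`, with respect to the unit normal `N = ∇ρ / |∇ρ|`; it equals `-(1/2) div N`.
The sphere of radius `r` has mean curvature `1 / r` with respect to its inner normal. -/
def meanCurvature (ρ : E3 → ℝ) (x : E3) : ℝ :=
  -(1 / 2) * LinearMap.trace ℝ E3 (fderiv ℝ (unitNormal ρ) x : E3 →ₗ[ℝ] E3)

/-- `∂W` is (non-strictly) mean convex: its mean curvature with respect to the unit normal
pointing into `W` is nonnegative. -/
def HasMeanConvexBdry (W : Set E3) : Prop :=
  ∀ (U : Set E3) (ρ : E3 → ℝ), IsDefiningFunction W U ρ →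
    ∀ x ∈ bdry W ∩ U, 0 ≤ meanCurvature ρ x

/-- `∂W` meets the sphere only orthogonally: at every common point of `∂W` and `𝕊²` the normal
of `∂W` is orthogonal to the normal of `𝕊²`, which at `x` is `x`. -/
def MeetsSphereOrthogonally (W : Set E3) : Prop :=
  ∀ (U : Set E3) (ρ : E3 → ℝ), IsDefiningFunction W U ρ →
    ∀ x ∈ bdry W ∩ U, x ∈ sphere (0 : E3) 1 → ⟪gradient ρ x, x⟫ = 0

/-- For `e`, `f` orthonormal: the closed half of the equatorial disk in the plane spanned by
`e` and `f` that is bounded by the diameter from `-e` to `e` and contains `f`.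
Its two corners are `e` and `-e`. -/
def closedHalfDisk (e f : E3) : Set E3 :=
  {x | x ∈ closedBall (0 : E3) 1 ∧ ∃ a b : ℝ, 0 ≤ b ∧ x = a • e + b • f}

/-- The tangent plane at `p` of a surface with (possibly cornered) boundary: the linear span of
the tangent vectors to the surface at `p`. -/
def tangentPlane (S : Set E3) (p : E3) : Submodule ℝ E3 :=
  Submodule.span ℝ (tangentConeAt ℝ S p)

/-- The surfaces `S` and `T` are tangent at the common point `p`. -/
def AreTangentAt (S T : Set E3) (p : E3) : Prop :=
  p ∈ S ∧ p ∈ T ∧ tangentPlane S p = tangentPlane T p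

/-- A closed halfball: the part of the unit ball on one side of a plane through the origin. -/
def IsClosedHalfBall (W : Set E3) : Prop :=
  ∃ v : E3, ‖v‖ = 1 ∧ W = {x | x ∈ closedBall (0 : E3) 1 ∧ 0 ≤ ⟪v, x⟫}

end FreeBoundary

end

open Filter Topology

namespace FreeBoundary

/-! Let `ν` be the unit normal of `∂W` at `p` pointing into `W`. Tangency makes it normal to the
half-disk, which is spanned by `p` and `f`. Write `y = ⟨f, x⟩` and `z = ⟨ν, x⟩`.

Everything rests on one comparison principle, `no_touch`. A region inside `W` cannot reach a limit
point of the complement if its boundary there has negative mean curvature and, on the sphere, its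
gradient points strictly into the ball. Inside the ball the contact transfers the sign of the second
derivatives to the defining function of `W`, against mean convexity. On the sphere the strict angle
contradicts orthogonality. Two families of comparison surfaces are used.

The first gives a strong maximum principle and a Hopf lemma at the corner in one stroke
(`barrier_nonpos`, `mem_below_of_tangent`). Suppose `W` fills the space just below the half-disk
near some inner point `q₀`. Let `Q` be the affine function vanishing on the line through `p` and
`q₀`, and let `ψ = y - A Q ^ 2`. Its positivity set is the inside of a parabola that is tangent to
the diameter at `p` and runs to `q₀`. For large `A` the gradient of `ψ` points into the ball at the
sphere contacts in question; for large `α` and small `ε` the graphs `z = -ε (exp (α ψ) - 1 - t)`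
cannot touch. So `W` contains what lies between the half-disk and the graph with `t = 0`, which
leaves `p` at a positive angle. This contradicts that the gradient at `p` is a positive multiple of
`ν`. Hence the half-disk lies in `∂W`, with `W` above it.

The second family rotates about the diameter (`upper_half_subset`): half-planes bounded by the
diameter, perturbed to spherical caps to make curvature and angle strict, sweep out the upper half
of the ball. A wedge around the half-disk inside `W` keeps contacts away from the axis. So `W`
contains the upper half-ball, hence the opposite half-disk, to which the first step applies again.
The whole equatorial disk then lies in `∂W`, and connectedness excludes points of `W` below it. -/

/-- `u`, `v`, `w` form an orthonormal frame of Euclidean three-space. -/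
structure Frame (u v w : E3) : Prop where
  norm_u : ‖u‖ = 1
  norm_v : ‖v‖ = 1
  norm_w : ‖w‖ = 1
  uv : ⟪u, v⟫ = 0
  uw : ⟪u, w⟫ = 0
  vw : ⟪v, w⟫ = 0

/-! ### Orthonormal frames -/

namespace Frame
variable {u v w : E3}

theorem orthonormal (h : Frame u v w) : Orthonormal ℝ ![u, v, w] := by
  constructor
  · intro i
    fin_cases i <;> simp [h.norm_u, h.norm_v, h.norm_w]
  · intro i j hij
    fin_cases i <;> fin_cases j <;>
      simp_all [h.uv, h.uw, h.vw, real_inner_comm u v, real_inner_comm u w, real_inner_comm v w]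

theorem exists_basis (h : Frame u v w) :
    ∃ b : OrthonormalBasis (Fin 3) ℝ E3, b 0 = u ∧ b 1 = v ∧ b 2 = w := by
  have hc : Fintype.card (Fin 3) = Module.finrank ℝ E3 := by simp
  let b := basisOfOrthonormalOfCardEqFinrank h.orthonormal hc
  have hb : ⇑b = ![u, v, w] := coe_basisOfOrthonormalOfCardEqFinrank h.orthonormal hc
  refine ⟨b.toOrthonormalBasis (by rw [hb]; exact h.orthonormal), ?_, ?_, ?_⟩ <;> simp [hb]

theorem norm_sq (h : Frame u v w) (x : E3) :
    ‖x‖ ^ 2 = ⟪u, x⟫ ^ 2 + ⟪v, x⟫ ^ 2 + ⟪w, x⟫ ^ 2 := by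
  obtain ⟨b, rfl, rfl, rfl⟩ := h.exists_basis
  rw [← b.sum_sq_inner_right x]
  simp [Fin.sum_univ_three]

theorem expand (h : Frame u v w) (x : E3) :
    x = ⟪u, x⟫ • u + ⟪v, x⟫ • v + ⟪w, x⟫ • w := by
  obtain ⟨b, rfl, rfl, rfl⟩ := h.exists_basis
  conv_lhs => rw [← b.sum_repr' x]
  simp [Fin.sum_univ_three]

theorem trace_eq (h : Frame u v w) (T : E3 →ₗ[ℝ] E3) :
    LinearMap.trace ℝ E3 T = ⟪u, T u⟫ + ⟪v, T v⟫ + ⟪w, T w⟫ := by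
  obtain ⟨b, rfl, rfl, rfl⟩ := h.exists_basis
  rw [LinearMap.trace_eq_sum_inner T b]
  simp [Fin.sum_univ_three]

theorem neg_v (h : Frame u v w) : Frame u (-v) w :=
  ⟨h.norm_u, by simp [h.norm_v], h.norm_w, by simp [h.uv], h.uw, by simp [h.vw]⟩

theorem self_u (h : Frame u v w) : ⟪u, u⟫ = 1 := by
  rw [real_inner_self_eq_norm_sq, h.norm_u]; norm_num

theorem self_v (h : Frame u v w) : ⟪v, v⟫ = 1 := by
  rw [real_inner_self_eq_norm_sq, h.norm_v]; norm_num

theorem self_w (h : Frame u v w) : ⟪w, w⟫ = 1 := by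
  rw [real_inner_self_eq_norm_sq, h.norm_w]; norm_num

end Frame

/-- Every nonzero vector is orthogonal to an orthonormal pair. -/
theorem exists_orthonormal_pair (g : E3) (hg : g ≠ 0) :
    ∃ u v : E3, Frame u v (‖g‖⁻¹ • g) := by
  have hn : ‖‖g‖⁻¹ • g‖ = 1 := norm_smul_inv_norm (𝕜 := ℝ) hg
  have ho : Orthonormal ℝ (({2} : Set (Fin 3)).domRestrict (fun _ : Fin 3 => ‖g‖⁻¹ • g)) := by
    constructor
    · intro i; exact hn
    · intro i j hij
      exact absurd (Subsingleton.elim i j) hij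
  obtain ⟨b, hb⟩ := ho.exists_orthonormalBasis_extension_of_card_eq (ι := Fin 3) (by simp)
  have h2 : b 2 = ‖g‖⁻¹ • g := hb 2 (by simp)
  refine ⟨b 0, b 1, ?_⟩
  rw [← h2]
  have := b.orthonormal
  exact ⟨this.1 0, this.1 1, this.1 2, this.2 (by decide), this.2 (by decide), this.2 (by decide)⟩

/-! ### Defining functions and mean curvature -/

namespace IsDefiningFunction
variable {W U : Set E3} {ρ : E3 → ℝ}

theorem contDiffAt (h : IsDefiningFunction W U ρ) {x : E3} (hx : x ∈ U) : ContDiffAt ℝ ∞ ρ x :=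
  h.smooth.contDiffAt (h.isOpen.mem_nhds hx)

theorem hasFDerivAt (h : IsDefiningFunction W U ρ) {x : E3} (hx : x ∈ U) :
    HasFDerivAt ρ (innerSL ℝ (gradient ρ x)) x := by
  exact ((h.contDiffAt hx).differentiableAt (by simp)).hasGradientAt.hasFDerivAt

theorem hasStrictFDerivAt (h : IsDefiningFunction W U ρ) {x : E3} (hx : x ∈ U) :
    HasStrictFDerivAt ρ (innerSL ℝ (gradient ρ x)) x :=
  (h.contDiffAt hx).hasStrictFDerivAt' (h.hasFDerivAt hx) (by simp)

theorem gradient_differentiableAt (h : IsDefiningFunction W U ρ) {x : E3} (hx : x ∈ U) :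
    DifferentiableAt ℝ (gradient ρ) x := by
  have h1 : ContDiffAt ℝ 1 (fderiv ℝ ρ) x :=
    (h.contDiffAt hx).fderiv_right (m := 1) (by norm_num; exact WithTop.coe_le_coe.2 le_top)
  exact ((InnerProductSpace.toDual ℝ E3).symm.toContinuousLinearEquiv.differentiable _).comp x
    (h1.differentiableAt (by simp))

theorem nonneg (h : IsDefiningFunction W U ρ) {x : E3} (hx : x ∈ U) (hW : x ∈ W) : 0 ≤ ρ x := by
  have : x ∈ W ∩ U := ⟨hW, hx⟩
  rw [h.inter_eq] at this
  exact this.2.2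

theorem mem (h : IsDefiningFunction W U ρ) {x : E3} (hx : x ∈ U) (hb : x ∈ closedBall (0 : E3) 1)
    (h0 : 0 ≤ ρ x) : x ∈ W := by
  have : x ∈ W ∩ U := by rw [h.inter_eq]; exact ⟨hx, hb, h0⟩
  exact this.1

end IsDefiningFunction

/-- The mean curvature of a level set in terms of the second derivative on its tangent plane. -/
theorem meanCurvature_eq {ρ : E3 → ℝ} {q u v : E3} (hd : DifferentiableAt ℝ (gradient ρ) q)
    (h0 : gradient ρ q ≠ 0) (hF : Frame u v (‖gradient ρ q‖⁻¹ • gradient ρ q)) :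
    meanCurvature ρ q = -(1 / 2) * (‖gradient ρ q‖⁻¹ *
      (⟪u, fderiv ℝ (gradient ρ) q u⟫ + ⟪v, fderiv ℝ (gradient ρ) q v⟫)) := by
  set n := gradient ρ q with hn
  set L := fderiv ℝ (gradient ρ) q with hL
  have hnn : ‖n‖ ≠ 0 := norm_ne_zero_iff.2 h0
  have hdn : DifferentiableAt ℝ (fun x => ‖gradient ρ x‖⁻¹) q :=
    (hd.norm ℝ h0).inv hnn
  have hN : HasFDerivAt (unitNormal ρ) _ q := hdn.hasFDerivAt.smul hd.hasFDerivAt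
  have hNd : DifferentiableAt ℝ (unitNormal ρ) q := hN.differentiableAt
  have tang : ∀ x : E3, ⟪x, n⟫ = 0 → ⟪x, fderiv ℝ (unitNormal ρ) q x⟫ = ‖n‖⁻¹ * ⟪x, L x⟫ := by
    intro x hx
    rw [hN.fderiv]
    simp [inner_add_right, real_inner_smul_right, ← hn, ← hL, hx]
  have hnear : ∀ᶠ x in 𝓝 q, ⟪unitNormal ρ x, unitNormal ρ x⟫ = 1 := by
    have : ∀ᶠ x in 𝓝 q, gradient ρ x ≠ 0 := hd.continuousAt.eventually_ne h0
    filter_upwards [this] with x hx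
    rw [real_inner_self_eq_norm_sq, unitNormal]
    have := norm_smul_inv_norm (𝕜 := ℝ) hx
    rw [show ‖‖gradient ρ x‖⁻¹ • gradient ρ x‖ = 1 from this]; norm_num
  -- The field has constant length, so its derivative has no normal component and only the
  -- tangential trace survives.
  have hnorm : ⟪unitNormal ρ q, fderiv ℝ (unitNormal ρ) q (unitNormal ρ q)⟫ = 0 := by
    have h1 := (hNd.hasFDerivAt.inner ℝ hNd.hasFDerivAt)
    have h2 : HasFDerivAt (fun x => ⟪unitNormal ρ x, unitNormal ρ x⟫) (0 : E3 →L[ℝ] ℝ) q :=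
      (hasFDerivAt_const (1 : ℝ) q).congr_of_eventuallyEq hnear
    have h3 := congrArg (fun T : E3 →L[ℝ] ℝ => T (unitNormal ρ q)) (h1.unique h2)
    simp [fderivInnerCLM_apply] at h3
    have h4 := real_inner_comm (fderiv ℝ (unitNormal ρ) q (unitNormal ρ q)) (unitNormal ρ q)
    linarith
  have hun : ⟪u, n⟫ = 0 := by
    have := hF.uw; rw [real_inner_smul_right] at this
    exact (mul_eq_zero.1 this).resolve_left (inv_ne_zero hnn)
  have hvn : ⟪v, n⟫ = 0 := by
    have := hF.vw; rw [real_inner_smul_right] at this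
    exact (mul_eq_zero.1 this).resolve_left (inv_ne_zero hnn)
  rw [meanCurvature, hF.trace_eq]
  simp only [ContinuousLinearMap.coe_coe]
  rw [tang u hun, tang v hvn]
  have : ‖n‖⁻¹ • n = unitNormal ρ q := rfl
  rw [this, hnorm]
  ring

/-! ### Topology of the region and its boundary surface -/

variable {W : Set E3}

theorem IsClosedRegion.isClosed (hW : IsClosedRegion W) : IsClosed W := by
  rw [← hW.closure_interior]; exact isClosed_closure

theorem IsClosedRegion.interior_subset_ball (hW : IsClosedRegion W) :
    interior W ⊆ ball (0 : E3) 1 := by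
  have := interior_mono hW.subset_ball
  rwa [interior_closedBall (0 : E3) one_ne_zero] at this

/-- Points of a closed region that are limits of points of the ball outside it are in `∂W`. -/
theorem IsClosedRegion.mem_bdry (hW : IsClosedRegion W) {q : E3} (hq : q ∈ W)
    (hq' : q ∈ closure (closedBall (0 : E3) 1 \ W)) : q ∈ bdry W := by
  rw [bdry, Metric.mem_closure_iff]
  intro r hr
  -- The intersection of two balls is convex; without a frontier point it would be split by
  -- `interior W` and `Wᶜ`.
  have hC : IsPreconnected (ball q r ∩ ball (0 : E3) 1) :=
    ((convex_ball q r).inter (convex_ball 0 1)).isPreconnected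
  have hO : IsOpen (ball q r ∩ Wᶜ) := isOpen_ball.inter hW.isClosed.isOpen_compl
  obtain ⟨x, hx, hxr⟩ : ∃ x ∈ interior W, dist q x < r := by
    rw [← hW.closure_interior] at hq; exact Metric.mem_closure_iff.1 hq r hr
  obtain ⟨y, ⟨hyB, hyW⟩, hyr⟩ := Metric.mem_closure_iff.1 hq' r hr
  obtain ⟨y', ⟨hy'r, hy'W⟩, hy'B⟩ : ((ball q r ∩ Wᶜ) ∩ ball (0 : E3) 1).Nonempty := by
    rw [← closure_ball (0 : E3) one_ne_zero] at hyB
    exact mem_closure_iff.1 hyB _ hO ⟨by rwa [mem_ball, dist_comm], hyW⟩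
  by_contra! hcon
  have hsub : ball q r ∩ ball (0 : E3) 1 ⊆ interior W ∪ Wᶜ := by
    rintro a ⟨ha, hab⟩
    by_cases haW : a ∈ W
    · left
      by_contra hai
      have := hcon a ⟨⟨subset_closure haW, hai⟩, hab⟩
      rw [mem_ball, dist_comm] at ha
      linarith
    · exact Or.inr haW
  obtain ⟨a, -, ha1, ha2⟩ := hC _ _ isOpen_interior hW.isClosed.isOpen_compl hsub
    ⟨x, ⟨by rwa [mem_ball, dist_comm], hW.interior_subset_ball hx⟩, hx⟩
    ⟨y', ⟨hy'r, hy'B⟩, hy'W⟩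
  exact ha2 (interior_subset ha1)

theorem IsClosedRegion.bdry_subset (hW : IsClosedRegion W) : bdry W ⊆ W :=
  closure_minimal (fun _ hx => hW.isClosed.frontier_subset hx.1) hW.isClosed

/-- If `ρ` were positive at `x`, then `W` would fill the ball near `x`, leaving no frontier points
in the open ball there. -/
theorem IsDefiningFunction.eq_zero {U : Set E3} {ρ : E3 → ℝ} (hW : IsClosedRegion W)
    (h : IsDefiningFunction W U ρ) {x : E3} (hx : x ∈ bdry W) (hxU : x ∈ U) : ρ x = 0 := by
  have hc : ContinuousAt ρ x := (h.contDiffAt hxU).continuousAt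
  refine le_antisymm ?_ (h.nonneg hxU (hW.bdry_subset hx))
  by_contra! hpos
  have hev : ∀ᶠ y in 𝓝 x, 0 < ρ y ∧ y ∈ U :=
    (hc.eventually (lt_mem_nhds hpos)).and (h.isOpen.mem_nhds hxU)
  obtain ⟨V, hVs, hVo, hxV⟩ := _root_.eventually_nhds_iff.1 hev
  obtain ⟨y, hyV, hyf, hyb⟩ := mem_closure_iff.1 hx V hVo hxV
  refine hyf.2 (mem_interior.2 ⟨V ∩ ball 0 1, ?_, hVo.inter isOpen_ball, hyV, hyb⟩)
  rintro a ⟨haV, hab⟩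
  exact h.mem (hVs a haV).2 (ball_subset_closedBall hab) (hVs a haV).1.le

/-! ### One-sided derivative tests -/

/-- Moving from a point of the closed ball into the ball. -/
theorem eventually_mem_closedBall {q u : E3} (hq : ‖q‖ ≤ 1) (hu : ‖q‖ = 1 → ⟪q, u⟫ < 0) :
    ∀ᶠ t : ℝ in 𝓝[>] 0, q + t • u ∈ closedBall (0 : E3) 1 := by
  have hexp : ∀ t : ℝ, ‖q + t • u‖ ^ 2 = ‖q‖ ^ 2 + t * (2 * ⟪q, u⟫ + t * ‖u‖ ^ 2) := by
    intro t
    rw [norm_add_sq_real, real_inner_smul_right, norm_smul, mul_pow, Real.norm_eq_abs, sq_abs]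
    ring
  rcases hq.lt_or_eq with h | h
  · have : ContinuousAt (fun t : ℝ => ‖q + t • u‖) 0 := by fun_prop
    have h2 : ∀ᶠ t : ℝ in 𝓝 0, ‖q + t • u‖ < 1 :=
      this.eventually (gt_mem_nhds (by simpa using h))
    filter_upwards [nhdsWithin_le_nhds h2] with t ht
    simpa using ht.le
  · have : ContinuousAt (fun t : ℝ => 2 * ⟪q, u⟫ + t * ‖u‖ ^ 2) 0 := by fun_prop
    have h2 : ∀ᶠ t : ℝ in 𝓝 0, 2 * ⟪q, u⟫ + t * ‖u‖ ^ 2 < 0 :=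
      this.eventually (gt_mem_nhds (by have := hu h; simp; linarith))
    filter_upwards [nhdsWithin_le_nhds h2, self_mem_nhdsWithin] with t ht ht0
    rw [mem_closedBall_zero_iff]
    have := hexp t
    have h3 : t * (2 * ⟪q, u⟫ + t * ‖u‖ ^ 2) < 0 := mul_neg_of_pos_of_neg ht0 ht
    rw [h] at this
    nlinarith [norm_nonneg (q + t • u)]

theorem deriv_nonneg_of_eventually {F : ℝ → ℝ} {m : ℝ} (hF : HasDerivAt F m 0) (h0 : F 0 = 0)
    (h : ∀ᶠ t in 𝓝[>] (0 : ℝ), 0 ≤ F t) : 0 ≤ m := by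
  have ht := hF.hasDerivWithinAt (s := Ioi 0)
  rw [hasDerivWithinAt_iff_tendsto_slope' (by simp)] at ht
  refine ge_of_tendsto ht ?_
  filter_upwards [h, self_mem_nhdsWithin] with t ht ht0
  rw [slope_def_field, h0, sub_zero, sub_zero]
  exact div_nonneg ht (le_of_lt ht0)

/-- A function vanishing to first order at `0` and nonnegative on the right has nonnegative
second derivative. -/
theorem deriv_deriv_nonneg_of_eventually {F F' : ℝ → ℝ} {m : ℝ}
    (hF : ∀ᶠ t in 𝓝 (0 : ℝ), HasDerivAt F (F' t) t) (hF' : HasDerivAt F' m 0) (h0 : F 0 = 0)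
    (h0' : F' 0 = 0) (h : ∀ᶠ t in 𝓝[>] (0 : ℝ), 0 ≤ F t) : 0 ≤ m := by
  by_contra! hm
  have ht := hF'.hasDerivWithinAt (s := Ioi 0)
  rw [hasDerivWithinAt_iff_tendsto_slope' (by simp)] at ht
  -- If `m < 0`, then `F'` is negative just right of `0`, and the mean value theorem makes `F`
  -- negative there.
  have hneg : ∀ᶠ t in 𝓝[>] (0 : ℝ), F' t < 0 := by
    filter_upwards [ht.eventually (gt_mem_nhds hm), self_mem_nhdsWithin] with t ht ht0
    rw [slope_def_field, h0', sub_zero, sub_zero] at ht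
    by_contra! hc
    exact absurd ht (not_lt.2 (div_nonneg hc (le_of_lt ht0)))
  obtain ⟨δ, hδ, hδs⟩ := Metric.eventually_nhds_iff.1 hF
  obtain ⟨δ', hδ', hδs'⟩ := (nhdsGT_basis (0 : ℝ)).eventually_iff.1 (hneg.and h)
  set a := min δ δ' / 2 with ha
  have ha0 : 0 < a := by have := lt_min hδ hδ'; linarith
  have haδ : a < δ := by have := min_le_left δ δ'; linarith
  have haδ' : a < δ' := by have := min_le_right δ δ'; linarith
  have hd : ∀ t ∈ Icc 0 a, HasDerivAt F (F' t) t := fun t ht => hδs (by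
    rw [Real.dist_eq, sub_zero, abs_of_nonneg ht.1]; linarith [ht.2])
  obtain ⟨c, hc, hce⟩ := exists_hasDerivAt_eq_slope F F' ha0
    (fun t ht => (hd t ht).continuousAt.continuousWithinAt)
    (fun t ht => hd t ⟨ht.1.le, ht.2.le⟩)
  have h1 := (hδs' ⟨hc.1, hc.2.trans haδ'⟩).1
  have h2 := (hδs' (show a ∈ Ioo 0 δ' from ⟨ha0, haδ'⟩)).2
  rw [h0, sub_zero, sub_zero] at hce
  rw [hce] at h1
  exact absurd h1 (not_lt.2 (div_nonneg h2 ha0.le))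

/-- One-sided comparison of a defining function with a direction. -/
theorem inner_gradient_nonneg {ρ : E3 → ℝ} {q n u : E3} (hd : HasFDerivAt ρ (innerSL ℝ n) q)
    (h0 : ρ q = 0) (h : ∀ᶠ t : ℝ in 𝓝[>] 0, 0 ≤ ρ (q + t • u)) : 0 ≤ ⟪n, u⟫ := by
  have hc : HasDerivAt (fun t : ℝ => q + t • u) u 0 := by
    simpa using ((hasDerivAt_id (0 : ℝ)).smul_const u).const_add q
  have hd' : HasFDerivAt ρ (innerSL ℝ n) (q + (0 : ℝ) • u) := by simpa using hd
  have := hd'.comp_hasDerivAt (0 : ℝ) hc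
  exact deriv_nonneg_of_eventually this (by simpa using h0) h

/-! ### The touching principle -/

/-- A mean convex region meeting the sphere orthogonally cannot be touched from inside by a
region `⟨g, h⟩ + B h > 0` of negative mean curvature that meets the sphere at an acute angle. -/
theorem no_touch (hW : IsClosedRegion W) (hsmooth : HasSmoothBdry W)
    (hmean : HasMeanConvexBdry W) (horth : MeetsSphereOrthogonally W)
    {q g v₁ v₂ : E3} {B : E3 → ℝ} (hq : q ∈ closure (closedBall (0 : E3) 1 \ W))
    (hg : g ≠ 0) (hF : Frame v₁ v₂ (‖g‖⁻¹ • g))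
    (hBc : Continuous B) (hB : ∀ (t : ℝ) h, B (t • h) = t ^ 2 * B h)
    (hpos : 0 < B v₁ + B v₂) (hN : ‖q‖ = 1 → ⟪q, g⟫ < 0)
    (hloc : ∀ᶠ x in 𝓝 q, x ∈ closedBall (0 : E3) 1 → 0 < ⟪g, x - q⟫ + B (x - q) → x ∈ W) :
    False := by
  have hqB : ‖q‖ ≤ 1 := by
    have : q ∈ closedBall (0 : E3) 1 :=
      closure_minimal sdiff_subset isClosed_closedBall hq
    simpa using this
  have hgpos : 0 < ⟪g, g⟫ := real_inner_self_pos.2 hg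
  have hray : ∀ u : E3, 0 < ⟪g, u⟫ → (‖q‖ = 1 → ⟪q, u⟫ < 0) →
      ∀ᶠ t : ℝ in 𝓝[>] 0, q + t • u ∈ W := by
    intro u hu huq
    have hc : Tendsto (fun t : ℝ => q + t • u) (𝓝[>] 0) (𝓝 q) := by
      have : ContinuousAt (fun t : ℝ => q + t • u) 0 := by fun_prop
      have := this.tendsto
      simp only [zero_smul, add_zero] at this
      exact this.mono_left nhdsWithin_le_nhds
    have hc2 : ∀ᶠ t : ℝ in 𝓝[>] 0, 0 < ⟪g, u⟫ + t * B u := by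
      have : ContinuousAt (fun t : ℝ => ⟪g, u⟫ + t * B u) 0 := by fun_prop
      exact nhdsWithin_le_nhds (this.eventually (lt_mem_nhds (by simpa using hu)))
    filter_upwards [hc.eventually hloc, eventually_mem_closedBall hqB huq, hc2,
      self_mem_nhdsWithin] with t h1 h2 h3 h4
    refine h1 h2 ?_
    have : q + t • u - q = t • u := by abel
    rw [this, hB, real_inner_smul_right]
    have h4' : 0 < t := h4
    have := mul_pos h4' h3
    linarith
  have hqW : q ∈ W := by
    have hc : Tendsto (fun t : ℝ => q + t • g) (𝓝[>] 0) (𝓝 q) := by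
      have : ContinuousAt (fun t : ℝ => q + t • g) 0 := by fun_prop
      have := this.tendsto
      simp only [zero_smul, add_zero] at this
      exact this.mono_left nhdsWithin_le_nhds
    exact hW.isClosed.mem_of_tendsto hc (hray g hgpos hN)
  have hqb := hW.mem_bdry hqW hq
  obtain ⟨U, ρ, hqU, hρ⟩ := hsmooth q hqb
  have hρ0 : ρ q = 0 := hρ.eq_zero hW hqb hqU
  have hd := hρ.hasFDerivAt hqU
  set n := gradient ρ q with hn
  have hn0 : n ≠ 0 := hρ.gradient_ne_zero q hqU
  have hnn : 0 < ⟪n, n⟫ := real_inner_self_pos.2 hn0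
  have hfirst : ∀ u : E3, 0 < ⟪g, u⟫ → (‖q‖ = 1 → ⟪q, u⟫ < 0) → 0 ≤ ⟪n, u⟫ := by
    intro u hu huq
    refine inner_gradient_nonneg hd hρ0 ?_
    have hc : Tendsto (fun t : ℝ => q + t • u) (𝓝[>] 0) (𝓝 q) := by
      have : ContinuousAt (fun t : ℝ => q + t • u) 0 := by fun_prop
      have := this.tendsto
      simp only [zero_smul, add_zero] at this
      exact this.mono_left nhdsWithin_le_nhds
    filter_upwards [hray u hu huq, hc.eventually (hρ.isOpen.mem_nhds hqU)] with t h1 h2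
    exact hρ.nonneg h2 h1
  rcases hqB.lt_or_eq with hlt | heq
  · -- interior contact
    have hne : ¬ ‖q‖ = 1 := hlt.ne
    set l := ⟪n, g⟫ / ⟪g, g⟫ with hl
    set m := n - l • g with hm
    have hgm : ⟪g, m⟫ = 0 := by
      rw [hm, inner_sub_right, real_inner_smul_right, hl, div_mul_cancel₀ _ hgpos.ne',
        real_inner_comm, sub_self]
    have hnm : ⟪n, m⟫ = ⟪m, m⟫ := by
      have : n = m + l • g := by rw [hm]; abel
      nth_rewrite 1 [this]
      rw [inner_add_left, real_inner_smul_left, hgm]; ring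
    have hm0 : m = 0 := by
      by_contra hm0
      have hmm : 0 < ⟪m, m⟫ := real_inner_self_pos.2 hm0
      set s := (⟪n, g⟫ + 1) / ⟪m, m⟫ with hs
      have := hfirst (g - s • m)
        (by rw [inner_sub_right, real_inner_smul_right, hgm]; simpa using hgpos)
        (fun h => absurd h hne)
      rw [inner_sub_right, real_inner_smul_right, hnm, hs, div_mul_cancel₀ _ hmm.ne'] at this
      linarith
    have hnl : n = l • g := by rw [hm] at hm0; exact sub_eq_zero.1 hm0
    have hl0 : 0 < l := by
      have h1 : 0 ≤ l := div_nonneg (hfirst g hgpos (fun h => absurd h hne)) hgpos.le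
      refine lt_of_le_of_ne h1 fun h => hn0 ?_
      rw [hnl, ← h, zero_smul]
    set L := fderiv ℝ (gradient ρ) q with hL
    have hLd : HasFDerivAt (gradient ρ) L q := (hρ.gradient_differentiableAt hqU).hasFDerivAt
    have hsecond : ∀ v : E3, ⟪g, v⟫ = 0 → 2 * l * B v ≤ ⟪v, L v⟫ := by
      intro v hv
      refine le_of_forall_pos_le_add fun ε hε => ?_
      set s := (-B v + ε / (2 * l)) / ⟪g, g⟫ with hs
      have hsg : s * ⟪g, g⟫ = -B v + ε / (2 * l) := div_mul_cancel₀ _ hgpos.ne'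
      -- The term in `g` bends the curve into the comparison region: the coefficient of `t ^ 2`
      -- there tends to `s ⟨g, g⟩ + B v = ε / (2 l) > 0`.
      set γ : ℝ → E3 := fun t => q + t • v + (t ^ 2) • (s • g) with hγ
      have hγd : ∀ t : ℝ, HasDerivAt γ (v + (2 * t) • (s • g)) t := by
        intro t
        have h1 := ((hasDerivAt_id t).smul_const v).const_add q
        have h2 := (hasDerivAt_pow 2 t).smul_const (s • g)
        have h3 := h1.add h2
        simp only [one_smul, Nat.cast_ofNat, Nat.add_one_sub_one, pow_one] at h3
        exact h3
      have hγ0 : γ 0 = q := by simp [hγ]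
      have hγc : Tendsto γ (𝓝 0) (𝓝 q) := by
        have := (hγd 0).continuousAt.tendsto
        rwa [hγ0] at this
      have hFd : ∀ᶠ t in 𝓝 (0 : ℝ), HasDerivAt (fun t => ρ (γ t))
          ⟪gradient ρ (γ t), v + (2 * t) • (s • g)⟫ t := by
        filter_upwards [hγc.eventually (hρ.isOpen.mem_nhds hqU)] with t ht
        exact (hρ.hasFDerivAt ht).comp_hasDerivAt t (hγd t)
      have hF'd : HasDerivAt (fun t : ℝ => ⟪gradient ρ (γ t), v + (2 * t) • (s • g)⟫)
          (⟪v, L v⟫ + 2 * s * ⟪n, g⟫) 0 := by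
        have hLd' : HasFDerivAt (gradient ρ) L (γ 0) := by rwa [hγ0]
        have h1 := hLd'.comp_hasDerivAt (0 : ℝ) (hγd 0)
        have h2 : HasDerivAt (fun t : ℝ => v + (2 * t) • (s • g)) ((2 : ℝ) • (s • g)) 0 := by
          have := (((hasDerivAt_id (0 : ℝ)).const_mul 2).smul_const (s • g)).const_add v
          simpa using this
        have h3 := h1.inner ℝ h2
        refine h3.congr_deriv ?_
        simp only [Function.comp_apply, hγ0, ← hn, mul_zero, zero_smul, add_zero,
          real_inner_smul_right]
        rw [real_inner_comm v]; ring
      have hin : ∀ᶠ t in 𝓝[>] (0 : ℝ), 0 ≤ ρ (γ t) := by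
        have hc2 : ∀ᶠ t : ℝ in 𝓝[>] 0, 0 < s * ⟪g, g⟫ + B (v + t • (s • g)) := by
          have : ContinuousAt (fun t : ℝ => s * ⟪g, g⟫ + B (v + t • (s • g))) 0 := by fun_prop
          refine nhdsWithin_le_nhds (this.eventually (lt_mem_nhds ?_))
          simp only [hsg, zero_smul, add_zero]
          have : 0 < ε / (2 * l) := by positivity
          linarith
        have hball : ∀ᶠ x in 𝓝 q, x ∈ closedBall (0 : E3) 1 :=
          closedBall_mem_nhds_of_mem (by simpa using hlt)
        have hall := hγc.mono_left (nhdsWithin_le_nhds (s := Ioi 0))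
        filter_upwards [hall.eventually hloc, hall.eventually hball,
          hall.eventually (hρ.isOpen.mem_nhds hqU), hc2, self_mem_nhdsWithin] with t h1 h2 h3 h4 h5
        refine hρ.nonneg h3 (h1 h2 ?_)
        have e : γ t - q = t • (v + t • (s • g)) := by
          simp only [hγ]; module
        rw [e, hB, real_inner_smul_right, inner_add_right, hv, real_inner_smul_right,
          real_inner_smul_right]
        have h5' : 0 < t := h5
        have := mul_pos (pow_pos h5' 2) h4
        nlinarith
      have hfin := deriv_deriv_nonneg_of_eventually hFd hF'd (by simp only [hγ0]; exact hρ0)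
        (by simp only [hγ0, mul_zero, zero_smul, add_zero, ← hn]
            rw [hnl, real_inner_smul_left, hv, mul_zero]) hin
      have e2 : s * ⟪n, g⟫ = l * (-B v) + ε / 2 := by
        rw [hnl, real_inner_smul_left, mul_left_comm, hsg]
        field_simp
      linarith
    have hnorm : ‖n‖⁻¹ • n = ‖g‖⁻¹ • g := by
      have hgn : ‖g‖ ≠ 0 := norm_ne_zero_iff.2 hg
      rw [hnl, norm_smul, Real.norm_of_nonneg hl0.le, smul_smul]
      congr 1
      field_simp
    have horthog : ∀ v : E3, ⟪v, ‖g‖⁻¹ • g⟫ = 0 → ⟪g, v⟫ = 0 := by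
      intro v hv
      rw [real_inner_smul_right] at hv
      rw [real_inner_comm]
      exact (mul_eq_zero.1 hv).resolve_left (inv_ne_zero (norm_ne_zero_iff.2 hg))
    have h1 := hsecond v₁ (horthog v₁ hF.uw)
    have h2 := hsecond v₂ (horthog v₂ hF.vw)
    have hmc := hmean U ρ hρ q ⟨hqb, hqU⟩
    rw [meanCurvature_eq (hρ.gradient_differentiableAt hqU) hn0
      (by rw [← hn, hnorm]; exact hF)] at hmc
    have hn1 : 0 < ‖n‖⁻¹ := inv_pos.2 (norm_pos_iff.2 hn0)
    have : 0 < 2 * l * (B v₁ + B v₂) := by positivity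
    have h3 : 0 < ‖n‖⁻¹ * (⟪v₁, L v₁⟫ + ⟪v₂, L v₂⟫) := mul_pos hn1 (by linarith)
    linarith
  · -- contact on the sphere
    have ho : ⟪n, q⟫ = 0 := horth U ρ hρ q ⟨hqb, hqU⟩ (by simpa using heq)
    have hgq := hN heq
    -- The direction `-n - s q` pairs with `n` to `-|n|²`, since `n ⟂ q`. The term `-s q` makes it
    -- enter both the ball and the comparison region.
    set s := (|⟪g, n⟫| + 1) / (-⟪q, g⟫) with hs
    have hs0 : 0 < s := by
      apply div_pos <;> [positivity; linarith]
    have hsq : s * (-⟪q, g⟫) = |⟪g, n⟫| + 1 := div_mul_cancel₀ _ (by linarith)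
    have := hfirst (-n - s • q)
      (by rw [inner_sub_right, inner_neg_right, real_inner_smul_right, real_inner_comm q g]
          have := le_abs_self ⟪g, n⟫
          linarith)
      (fun _ => by
        rw [inner_sub_right, inner_neg_right, real_inner_smul_right, real_inner_comm, ho,
          real_inner_self_eq_norm_sq, heq]
        linarith)
    rw [inner_sub_right, inner_neg_right, real_inner_smul_right, ho] at this
    linarith

/-! ### Estimates for the barrier -/

theorem Frame.rotate_vw {u v w : E3} (h : Frame u v w) {c s : ℝ} (hcs : c ^ 2 + s ^ 2 = 1) :
    Frame u (c • v - s • w) (c • w + s • v) := by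
  have hvw := h.vw
  have hwv : ⟪w, v⟫ = 0 := by rw [real_inner_comm]; exact h.vw
  have n1 : ⟪c • v - s • w, c • v - s • w⟫ = 1 := by
    simp only [inner_sub_left, inner_sub_right, real_inner_smul_left, real_inner_smul_right,
      h.self_v, h.self_w, hvw, hwv]
    linarith
  have n2 : ⟪c • w + s • v, c • w + s • v⟫ = 1 := by
    simp only [inner_add_left, inner_add_right, real_inner_smul_left, real_inner_smul_right,
      h.self_v, h.self_w, hvw, hwv]
    linarith
  refine ⟨h.norm_u, ?_, ?_, ?_, ?_, ?_⟩
  · rw [real_inner_self_eq_norm_sq] at n1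
    exact (pow_eq_one_iff_of_nonneg (norm_nonneg _) two_ne_zero).1 n1
  · rw [real_inner_self_eq_norm_sq] at n2
    exact (pow_eq_one_iff_of_nonneg (norm_nonneg _) two_ne_zero).1 n2
  · simp [inner_sub_right, real_inner_smul_right, h.uv, h.uw]
  · simp [inner_add_right, real_inner_smul_right, h.uv, h.uw]
  · simp only [inner_sub_left, inner_add_right, real_inner_smul_left, real_inner_smul_right,
      h.self_v, h.self_w, hvw, hwv]
    ring

theorem Frame.cycle {u v w : E3} (h : Frame u v w) : Frame w u v :=
  ⟨h.norm_w, h.norm_u, h.norm_v, by rw [real_inner_comm]; exact h.uw,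
    by rw [real_inner_comm]; exact h.vw, h.uv⟩

/-- Square the inequality `1 + s / 2 ≤ exp (s / 2)`, whose left side is nonnegative for `s ≥ -2`. -/
theorem quadratic_le_exp {s : ℝ} (hs : -2 ≤ s) : 1 + s + s ^ 2 / 4 ≤ Real.exp s := by
  have h := Real.add_one_le_exp (s / 2)
  have h2 : Real.exp s = Real.exp (s / 2) ^ 2 := by rw [← Real.exp_nat_mul]; congr 1; ring
  rw [h2]
  nlinarith

/-- The quantity is the radial derivative of `ψ`. A sphere point to the right of `x₀` and close to
the plane lies beyond the chord from `p` to `q₀`, quantitatively `Q ≥ y d / 4`, so for large `A` the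
term `2 A Q y₀` beats `y`. -/
theorem barrier_boundary_sign_right {x₀ y₀ x y z A k Q d : ℝ} (hx₀ : x₀ ^ 2 + y₀ ^ 2 < 1)
    (hd : d = 1 - x₀ ^ 2 - y₀ ^ 2) (hy0 : 0 < y) (hy : y < y₀) (hs : x ^ 2 + y ^ 2 + z ^ 2 = 1)
    (hz2 : z ^ 2 ≤ k ^ 2 * y) (hk2 : k ^ 2 ≤ d / 2) (hA : 0 < A)
    (hQ : Q = y₀ * (x - 1) + (1 - x₀) * y) (hA2 : 2 < A * y₀ * d) (hxx : x₀ ≤ x) :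
    y - 2 * A * Q * (Q + y₀) < 0 := by
  have hy₀ : 0 < y₀ := hy0.trans hy
  have hd0 : 0 < d := by linarith
  have hy₀1 : y₀ < 1 := by nlinarith only [sq_nonneg x₀, hx₀]
  have hx1 : x ≤ 1 := by nlinarith only [sq_nonneg y, sq_nonneg z, hs]
  have hx₀1 : x₀ < 1 := by nlinarith only [sq_nonneg y₀, hx₀]
  have hx₀n : -1 < x₀ := by nlinarith only [sq_nonneg y₀, hx₀]
  have h1 : Q * (1 + x) = (1 - x₀) * (1 + x) * y - y₀ * (y ^ 2 + z ^ 2) := by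
    have : y ^ 2 + z ^ 2 = 1 - x ^ 2 := by linarith
    rw [this, hQ]; ring
  have h2 : (1 - x₀) * (1 + x₀) ≤ (1 - x₀) * (1 + x) :=
    mul_le_mul_of_nonneg_left (by linarith) (by linarith)
  have e1 := mul_le_mul_of_nonneg_left hy.le (mul_pos hy₀ hy0).le
  have e2 : y₀ * z ^ 2 ≤ 1 * z ^ 2 := mul_le_mul_of_nonneg_right hy₀1.le (sq_nonneg z)
  have a1 := mul_le_mul_of_nonneg_right h2 hy0.le
  have a2 := mul_le_mul_of_nonneg_right hk2 hy0.le
  have a3 : d * y = (1 - x₀ ^ 2 - y₀ ^ 2) * y := by rw [hd]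
  have h4 : y * (d / 2) ≤ Q * (1 + x) := by
    rw [h1]; linarith
  have hx2 : 0 < 1 + x := by linarith
  have hp : 0 < y * (d / 2) := by positivity
  have hQ0 : 0 < Q := by
    by_contra! hc
    have := mul_nonpos_of_nonpos_of_nonneg hc hx2.le
    linarith
  have h5 : y * (d / 4) ≤ Q := by
    have : Q * (1 + x) ≤ Q * 2 := mul_le_mul_of_nonneg_left (by linarith) hQ0.le
    linarith
  have h6 : A * y₀ * (y * (d / 4)) ≤ A * y₀ * Q :=
    mul_le_mul_of_nonneg_left h5 (mul_pos hA hy₀).le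
  have h7 : y * 2 < y * (A * y₀ * d) := mul_lt_mul_of_pos_left hA2 hy0
  have : 0 < A * Q * Q := by positivity
  linarith

/-- A sphere point to the left of `x₀` is far from the chord, `-Q ≥ y₀ d / 4`, so `A Q ^ 2 ≥ 1 > y`
and the point is outside the parabola. -/
theorem barrier_boundary_left {x₀ y₀ x y z A k Q d : ℝ} (hx₀ : x₀ ^ 2 + y₀ ^ 2 < 1)
    (hd : d = 1 - x₀ ^ 2 - y₀ ^ 2) (hy0 : 0 < y) (hy : y < y₀) (hs : x ^ 2 + y ^ 2 + z ^ 2 = 1)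
    (hz2 : z ^ 2 ≤ k ^ 2 * y) (hk2 : k ^ 2 ≤ d / 2) (hA : 0 < A)
    (hQ : Q = y₀ * (x - 1) + (1 - x₀) * y) (hA1 : 16 ≤ A * y₀ ^ 2 * d ^ 2)
    (hQA : A * Q ^ 2 < y) : x₀ ≤ x := by
  by_contra! hxx
  have hy₀ : 0 < y₀ := hy0.trans hy
  have hd0 : 0 < d := by linarith
  have hy₀1 : y₀ < 1 := by nlinarith only [sq_nonneg x₀, hx₀]
  have hx₀1 : x₀ < 1 := by nlinarith only [sq_nonneg y₀, hx₀]
  have hx₀n : -1 < x₀ := by nlinarith only [sq_nonneg y₀, hx₀]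
  have hxx2 : x₀ ^ 2 + d / 2 ≤ x ^ 2 := by
    have e1 : k ^ 2 * y ≤ k ^ 2 * 1 :=
      mul_le_mul_of_nonneg_left (by linarith) (sq_nonneg k)
    have e2 : y ^ 2 ≤ y₀ ^ 2 := pow_le_pow_left₀ hy0.le hy.le 2
    linarith
  have hxneg : x < -|x₀| := by
    have hlt : |x₀| < |x| := sq_lt_sq.1 (by linarith)
    rcases abs_cases x with ⟨h, _⟩ | ⟨h, _⟩
    · have := le_abs_self x₀; linarith
    · linarith
  have h1 : d / 4 ≤ x₀ - x := by
    have ha : |x₀| < 1 := abs_lt.2 ⟨hx₀n, hx₀1⟩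
    have hb : -1 ≤ x := by nlinarith only [sq_nonneg y, sq_nonneg z, hs]
    have he : -|x₀| ≤ x₀ := neg_abs_le x₀
    have h0 := abs_nonneg x₀
    have h2 : (-x - |x₀|) * (-x + |x₀|) = x ^ 2 - x₀ ^ 2 := by rw [← sq_abs x₀]; ring
    have h3 : (-x - |x₀|) * (-x + |x₀|) ≤ (-x - |x₀|) * 2 :=
      mul_le_mul_of_nonneg_left (by linarith) (by linarith)
    linarith
  have h2 : y₀ * (d / 4) ≤ -Q := by
    have e1 : (1 - x₀) * y ≤ (1 - x₀) * y₀ := mul_le_mul_of_nonneg_left hy.le (by linarith)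
    have e2 := mul_le_mul_of_nonneg_left h1 hy₀.le
    rw [hQ]; linarith
  have h3 : (y₀ * (d / 4)) ^ 2 ≤ (-Q) ^ 2 := pow_le_pow_left₀ (by positivity) h2 2
  have h4 := mul_le_mul_of_nonneg_left h3 hA.le
  have h5 : A * (y₀ * (d / 4)) ^ 2 = A * y₀ ^ 2 * d ^ 2 / 16 := by ring
  rw [neg_sq] at h4
  linarith

/-- The gradient of the barrier points into the ball along the sphere. -/
theorem barrier_boundary_sign {x₀ y₀ x y z A k Q d : ℝ} (hx₀ : x₀ ^ 2 + y₀ ^ 2 < 1)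
    (hd : d = 1 - x₀ ^ 2 - y₀ ^ 2) (hy0 : 0 < y) (hy : y < y₀) (hs : x ^ 2 + y ^ 2 + z ^ 2 = 1)
    (hz : |z| ≤ k * y) (hk0 : 0 ≤ k) (hk : k ≤ d / 2) (hA : 0 < A)
    (hQ : Q = y₀ * (x - 1) + (1 - x₀) * y) (hA1 : 16 ≤ A * y₀ ^ 2 * d ^ 2) (hA2 : 2 < A * y₀ * d)
    (hQA : A * Q ^ 2 < y) : y - 2 * A * Q * (Q + y₀) < 0 := by
  have hd1 : d ≤ 1 := by linarith [sq_nonneg x₀, sq_nonneg y₀]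
  have hy₀1 : y₀ < 1 := by nlinarith only [sq_nonneg x₀, hx₀]
  have hk2 : k ^ 2 ≤ d / 2 := by
    have : k * k ≤ k * 1 := mul_le_mul_of_nonneg_left (by linarith) hk0
    linarith
  have hz2 : z ^ 2 ≤ k ^ 2 * y := by
    have h1 : z ^ 2 ≤ (k * y) ^ 2 := by
      rw [← sq_abs z]; exact pow_le_pow_left₀ (abs_nonneg z) hz 2
    have h2 : y * y ≤ y * 1 := mul_le_mul_of_nonneg_left (by linarith) hy0.le
    have h3 := mul_le_mul_of_nonneg_left h2 (sq_nonneg k)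
    linarith
  exact barrier_boundary_sign_right hx₀ hd hy0 hy hs hz2 hk2 hA hQ hA2
    (barrier_boundary_left hx₀ hd hy0 hy hs hz2 hk2 hA hQ hA1 hQA)

/-- Bounds for the gradient `(a, b)` of `y - A Q ^ 2`. -/
theorem barrier_gradient_bounds {x₀ y₀ A q a b : ℝ} (hx₀ : x₀ ^ 2 + y₀ ^ 2 < 1) (hy₀ : 0 < y₀)
    (hA : 1 ≤ A) (hq : A * q ^ 2 < 1) (ha : a = -(2 * A * q * y₀))
    (hb : b = 1 - 2 * A * q * (1 - x₀)) :
    y₀ ^ 2 ≤ 5 * (a ^ 2 + b ^ 2) ∧ a ^ 2 + b ^ 2 ≤ (1 + 6 * A) ^ 2 := by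
  have hy₀1 : y₀ < 1 := by nlinarith only [sq_nonneg x₀, hx₀]
  have hx₀1 : x₀ < 1 := by nlinarith only [sq_nonneg y₀, hx₀]
  have hx₀n : -1 < x₀ := by nlinarith only [sq_nonneg y₀, hx₀]
  constructor
  · have h1 : a * (1 - x₀) - b * y₀ = -y₀ := by rw [ha, hb]; ring
    have h2 : (a * (1 - x₀) - b * y₀) ^ 2 + (a * y₀ + b * (1 - x₀)) ^ 2 =
        (a ^ 2 + b ^ 2) * (y₀ ^ 2 + (1 - x₀) ^ 2) := by ring
    rw [h1] at h2
    have h3 : y₀ ^ 2 + (1 - x₀) ^ 2 ≤ 5 := by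
      have : (1 - x₀) ^ 2 = 1 - 2 * x₀ + x₀ ^ 2 := by ring
      linarith
    have h4 := mul_le_mul_of_nonneg_left h3 (by positivity : 0 ≤ a ^ 2 + b ^ 2)
    linarith [sq_nonneg (a * y₀ + b * (1 - x₀))]
  · have hQ1 : |q| ≤ 1 := by
      have h1 : 1 * q ^ 2 ≤ A * q ^ 2 := mul_le_mul_of_nonneg_right hA (sq_nonneg q)
      exact (sq_le_one_iff_abs_le_one q).1 (by linarith)
    have hAQ : |A * q| ≤ A := by
      rw [abs_mul, abs_of_pos (by linarith : 0 < A)]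
      exact mul_le_of_le_one_right (by linarith) hQ1
    have h0 := abs_nonneg (A * q)
    have h3 : |a| ≤ 2 * A := by
      rw [ha, abs_neg, mul_assoc 2, abs_mul, abs_mul, abs_of_pos hy₀, abs_two]
      have := mul_le_mul_of_nonneg_left hy₀1.le (by positivity : 0 ≤ 2 * |A * q|)
      linarith
    have h4 : |b| ≤ 1 + 4 * A := by
      have e : |2 * A * q * (1 - x₀)| ≤ 4 * A := by
        rw [mul_assoc 2, abs_mul, abs_mul, abs_two, abs_of_pos (by linarith : 0 < 1 - x₀)]
        have := mul_le_mul_of_nonneg_left (by linarith : 1 - x₀ ≤ 2)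
          (by positivity : 0 ≤ 2 * |A * q|)
        linarith
      have := abs_le.1 e
      rw [hb, abs_le]; constructor <;> linarith
    have h5 : a ^ 2 ≤ (2 * A) ^ 2 := sq_le_sq' (abs_le.1 h3).1 (abs_le.1 h3).2
    have h6 : b ^ 2 ≤ (1 + 4 * A) ^ 2 := sq_le_sq' (abs_le.1 h4).1 (abs_le.1 h4).2
    linarith [sq_nonneg A]

/-- A frame adapted to the graph with gradient `ν + θ (a p + b f)`. -/
theorem Frame.exists_adapted {p f ν : E3} (hF : Frame p f ν) {a b : ℝ} (θ : ℝ)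
    (hab : 0 < a ^ 2 + b ^ 2) {g u : E3} (hu : u = a • p + b • f) (hg : g = ν + θ • u) :
    ∃ v₁ v₂ : E3, Frame v₁ v₂ (‖g‖⁻¹ • g) ∧
      ⟪u, v₂⟫ ^ 2 * (1 + θ ^ 2 * (a ^ 2 + b ^ 2)) = a ^ 2 + b ^ 2 := by
  set N := Real.sqrt (a ^ 2 + b ^ 2) with hN
  have hN0 : 0 < N := Real.sqrt_pos.2 hab
  have hNsq : N ^ 2 = a ^ 2 + b ^ 2 := Real.sq_sqrt hab.le
  set S := Real.sqrt (1 + (θ * N) ^ 2) with hS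
  have hS0 : 0 < S := Real.sqrt_pos.2 (by positivity)
  have hSsq : S ^ 2 = 1 + (θ * N) ^ 2 := Real.sq_sqrt (by positivity)
  -- One rotation in the plane of `p` and `f` aligns `w` with `u`; a second one, in the plane of `w`
  -- and `ν`, aligns the normal with `g`.
  have hF1 : Frame ν ((b / N) • p - (a / N) • f) ((b / N) • f + (a / N) • p) :=
    hF.cycle.rotate_vw (by rw [div_pow, div_pow, ← add_div, hNsq, add_comm, div_self hab.ne'])
  set v₁ : E3 := (b / N) • p - (a / N) • f with hv₁
  set w : E3 := (b / N) • f + (a / N) • p with hw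
  have hF2 := hF1.cycle.cycle.rotate_vw (c := 1 / S) (s := θ * N / S)
    (by rw [div_pow, div_pow, ← add_div, hSsq, one_pow, div_self (by positivity)])
  have huw : u = N • w := by
    rw [hu, hw, smul_add, smul_smul, smul_smul, mul_div_cancel₀ _ hN0.ne',
      mul_div_cancel₀ _ hN0.ne', add_comm]
  have hgS : g = S • ((1 / S) • ν + (θ * N / S) • w) := by
    rw [hg, huw, smul_add S, smul_smul θ, smul_smul S, smul_smul S, mul_div_cancel₀ _ hS0.ne',
      mul_div_cancel₀ _ hS0.ne', one_smul]
  have hgn : ‖g‖ = S := by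
    rw [hgS, norm_smul, hF2.norm_w, mul_one, Real.norm_of_nonneg hS0.le]
  have hgg : ‖g‖⁻¹ • g = (1 / S) • ν + (θ * N / S) • w := by
    rw [hgn, hgS, smul_smul, inv_mul_cancel₀ hS0.ne', one_smul]
  refine ⟨v₁, (1 / S) • w - (θ * N / S) • ν, by rw [hgg]; exact hF2, ?_⟩
  have hwv : ⟪w, ν⟫ = 0 := by rw [real_inner_comm]; exact hF1.uw
  have hww : ⟪w, w⟫ = 1 := hF1.self_w
  have hval : ⟪u, (1 / S) • w - (θ * N / S) • ν⟫ = N / S := by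
    rw [huw, real_inner_smul_left, inner_sub_right, real_inner_smul_right, real_inner_smul_right,
      hwv, hww]
    ring
  have hS2 : 1 + θ ^ 2 * (a ^ 2 + b ^ 2) = S ^ 2 := by rw [hSsq, mul_pow, hNsq]
  rw [hval, hS2, div_pow, div_mul_cancel₀ _ (by positivity), hNsq]

/-- Quadratic lower bound for `exp (α (l - A m ^ 2)) - 1`. -/
theorem exp_barrier_bound {α A l m : ℝ} (hα : 0 ≤ α) (hA : 0 ≤ A)
    (h1 : -2 ≤ α * (l - A * m ^ 2)) (h2 : α * A * m ^ 2 ≤ 4) :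
    α * l + (α ^ 2 * l ^ 2 / 8 - 2 * α * A * m ^ 2) ≤ Real.exp (α * (l - A * m ^ 2)) - 1 := by
  have h := quadratic_le_exp h1
  have e1 := mul_le_mul_of_nonneg_left h2 (by positivity : 0 ≤ α * A * m ^ 2)
  have e2 := sq_nonneg (α * l - 2 * (α * A * m ^ 2))
  have e3 : (α * (l - A * m ^ 2)) ^ 2 = (α * l - 2 * (α * A * m ^ 2)) ^ 2 / 2 + (α * l) ^ 2 / 2
      - (α * A * m ^ 2) ^ 2 := by ring
  rw [e3] at h
  linarith

/-! ### Barrier graphs do not touch -/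

/-- The graphs `⟨ν, x⟩ = -ε (exp (α ψ) - 1 - t)`, `ψ = y - A Q ^ 2`, cannot touch a mean convex
region from inside, if the gradient `ν + θ (a p + b f)` of the defining function at the contact
point points into the ball and `α` is large. -/
theorem no_touch_graph (hW : IsClosedRegion W) (hsmooth : HasSmoothBdry W)
    (hmean : HasMeanConvexBdry W) (horth : MeetsSphereOrthogonally W)
    {p f ν q m u : E3} (hF : Frame p f ν) {A α ε t a b y₀ θ : ℝ} {Q ψ : E3 → ℝ}
    (hm : ‖m‖ ^ 2 ≤ 5) (hQ : ∀ x, Q x = ⟪m, x⟫ - y₀)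
    (hψ : ∀ x, ψ x = ⟪f, x⟫ - A * Q x ^ 2)
    (hu : u = a • p + b • f) (hum : u = f - (2 * A * Q q) • m) (hab : 0 < a ^ 2 + b ^ 2)
    (hA : 0 < A) (hα0 : 0 < α) (hα : 160 * A < α * (a ^ 2 + b ^ 2)) (hε : 0 < ε)
    (hθ : θ = ε * Real.exp (α * ψ q) * α) (hθ1 : θ ^ 2 * (a ^ 2 + b ^ 2) ≤ 1)
    (hq : q ∈ closure (closedBall (0 : E3) 1 \ W))
    (hN : ‖q‖ = 1 → ⟪q, ν + θ • u⟫ < 0)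
    (hqt : ⟪ν, q⟫ + ε * (Real.exp (α * ψ q) - 1 - t) = 0)
    (hloc : ∀ᶠ x in 𝓝 q, x ∈ closedBall (0 : E3) 1 →
      0 < ⟪ν, x⟫ + ε * (Real.exp (α * ψ x) - 1 - t) → x ∈ W) : False := by
  obtain ⟨v₁, v₂, hFr, hv⟩ := hF.exists_adapted θ hab hu rfl
  set E := Real.exp (α * ψ q) with hE
  have hE0 : 0 < E := Real.exp_pos _
  have hg : ν + θ • u ≠ 0 := by
    intro h
    have h1 : ⟪ν, ν + θ • u⟫ = 0 := by rw [h, inner_zero_right]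
    rw [inner_add_right, hF.self_w, hu, real_inner_smul_right, inner_add_right,
      real_inner_smul_right, real_inner_smul_right, real_inner_comm, hF.uw, real_inner_comm,
      hF.vw] at h1
    norm_num at h1
  -- `B` is the quadratic part of the lower bound `exp_barrier_bound` for the barrier about `q`,
  -- scaled by `ε E`.
  refine no_touch hW hsmooth hmean horth hq hg hFr
    (B := fun h => ε * E * (α ^ 2 * ⟪u, h⟫ ^ 2 / 8 - 2 * α * A * ⟪m, h⟫ ^ 2))
    (by fun_prop) (fun t h => by simp only [real_inner_smul_right]; ring) ?_ hN ?_
  -- As `|m|² ≤ 5` and `⟨u, v₂⟩² ≥ |u|² / 2`, the trace of `B` is at least `ε E (α² |u|² / 16 - 10 α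
  -- A)`, positive because `160 A < α |u|²`.
  · have hm2 : ⟪m, v₁⟫ ^ 2 + ⟪m, v₂⟫ ^ 2 ≤ 5 := by
      have := hFr.norm_sq m
      rw [real_inner_comm, real_inner_comm m v₂] at this
      linarith [sq_nonneg ⟪‖ν + θ • u‖⁻¹ • (ν + θ • u), m⟫]
    have hl : a ^ 2 + b ^ 2 ≤ 2 * ⟪u, v₂⟫ ^ 2 := by
      have := mul_le_mul_of_nonneg_left hθ1 (sq_nonneg ⟪u, v₂⟫)
      linarith
    have h1 := mul_le_mul_of_nonneg_left hl (by positivity : 0 ≤ α ^ 2)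
    have h2 := mul_le_mul_of_nonneg_left hm2 (by positivity : 0 ≤ α * A)
    have h3 := mul_lt_mul_of_pos_left hα hα0
    have h4 : 0 ≤ α ^ 2 * ⟪u, v₁⟫ ^ 2 := by positivity
    have : 0 < ε * E := by positivity
    rw [← mul_add]
    refine mul_pos this ?_
    linarith
  · have hc1 : ∀ᶠ x in 𝓝 q, -2 < α * (⟪u, x - q⟫ - A * ⟪m, x - q⟫ ^ 2) := by
      have : ContinuousAt (fun x => α * (⟪u, x - q⟫ - A * ⟪m, x - q⟫ ^ 2)) q := by fun_prop
      exact this.eventually (lt_mem_nhds (by simp))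
    have hc2 : ∀ᶠ x in 𝓝 q, α * A * ⟪m, x - q⟫ ^ 2 < 4 := by
      have : ContinuousAt (fun x => α * A * ⟪m, x - q⟫ ^ 2) q := by fun_prop
      exact this.eventually (gt_mem_nhds (by simp))
    filter_upwards [hloc, hc1, hc2] with x h1 h2 h3 hxB hpos
    refine h1 hxB (lt_of_lt_of_le hpos ?_)
    have hψx : ψ x = ψ q + (⟪u, x - q⟫ - A * ⟪m, x - q⟫ ^ 2) := by
      have e1 : ⟪u, x - q⟫ = ⟪f, x - q⟫ - 2 * A * Q q * ⟪m, x - q⟫ := by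
        rw [hum, inner_sub_left, real_inner_smul_left]
      rw [hψ, hψ, e1, hQ, hQ, inner_sub_right, inner_sub_right]
      ring
    have h4 := exp_barrier_bound hα0.le hA.le h2.le h3.le
    have h5 := mul_le_mul_of_nonneg_left h4 (by positivity : 0 ≤ ε * E)
    have h6 : Real.exp (α * ψ x) = E * Real.exp (α * (⟪u, x - q⟫ - A * ⟪m, x - q⟫ ^ 2)) := by
      rw [hψx, hE, ← Real.exp_add, mul_add]
    rw [h6, inner_add_left, real_inner_smul_left, inner_sub_right, hθ]
    linarith

/-- The graphs `⟨ν, x⟩ = -ε (exp (α ψ) - 1 - t)` cannot touch a mean convex region from inside. -/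
theorem no_contact_graph (hW : IsClosedRegion W) (hsmooth : HasSmoothBdry W)
    (hmean : HasMeanConvexBdry W) (horth : MeetsSphereOrthogonally W)
    {p f ν q m : E3} (hF : Frame p f ν) {x₀ y₀ A α ε t d : ℝ} {Q ψ : E3 → ℝ}
    (hx₀ : x₀ ^ 2 + y₀ ^ 2 < 1) (hd : d = 1 - x₀ ^ 2 - y₀ ^ 2)
    (hm : m = y₀ • p + (1 - x₀) • f) (hQ : ∀ x, Q x = ⟪m, x⟫ - y₀)
    (hψ : ∀ x, ψ x = ⟪f, x⟫ - A * Q x ^ 2)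
    (hA : 1 ≤ A) (hA1 : 16 ≤ A * y₀ ^ 2 * d ^ 2) (hA2 : 2 < A * y₀ * d)
    (hα : α * y₀ ^ 2 = 2000 * A) (hε : 0 < ε) (hε1 : ε * Real.exp α * α * (1 + 6 * A) ≤ 1)
    (hε2 : ε * Real.exp α * α ≤ d / 2)
    (hq : q ∈ closure (closedBall (0 : E3) 1 \ W)) (hy0 : 0 < ⟪f, q⟫) (hy : ⟪f, q⟫ < y₀)
    (ht : 0 < t) (hz : ⟪ν, q⟫ ≤ 0) (hqt : ⟪ν, q⟫ + ε * (Real.exp (α * ψ q) - 1 - t) = 0)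
    (hloc : ∀ᶠ x in 𝓝 q, x ∈ closedBall (0 : E3) 1 →
      0 < ⟪ν, x⟫ + ε * (Real.exp (α * ψ x) - 1 - t) → x ∈ W) : False := by
  have hy₀ : 0 < y₀ := hy0.trans hy
  have hα0 : 0 < α := by
    by_contra! h
    nlinarith [sq_nonneg y₀]
  have hd0 : 0 < d := by linarith
  have hy₀1 : y₀ < 1 := by nlinarith [sq_nonneg x₀]
  have hx₀1 : x₀ < 1 := by nlinarith [sq_nonneg y₀]
  have hx₀n : -1 < x₀ := by nlinarith [sq_nonneg y₀]
  have hE1 : 1 + t ≤ Real.exp (α * ψ q) := by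
    by_contra! h
    nlinarith
  have hψ0 : 0 < ψ q := by
    by_contra! h
    have : Real.exp (α * ψ q) ≤ 1 := Real.exp_le_one_iff.2 (by nlinarith)
    linarith
  have hQy : A * Q q ^ 2 < ⟪f, q⟫ := by have := hψ q; linarith
  have hψy : ψ q ≤ ⟪f, q⟫ := by have := hψ q; nlinarith [sq_nonneg (Q q)]
  set E := Real.exp (α * ψ q) with hE
  have hE0 : 0 < E := Real.exp_pos _
  have hEα : E ≤ Real.exp α := Real.exp_le_exp.2 (by nlinarith)
  set k := ε * Real.exp α * α with hk
  have hk0 : 0 < k := by positivity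
  set θ := ε * E * α with hθ
  have hθ0 : 0 < θ := by positivity
  have hθk : θ ≤ k := by
    rw [hθ, hk]; gcongr
  -- By `exp s - 1 ≤ s exp s` the depth of the contact point is at most `θ ψ ≤ k y`, so it is close
  -- to the plane.
  have hzk : |⟪ν, q⟫| ≤ k * ⟪f, q⟫ := by
    rw [abs_of_nonpos hz]
    have h1 : E - 1 ≤ E * (α * ψ q) := by
      have h2 := Real.add_one_le_exp (-(α * ψ q))
      have h3 : E * Real.exp (-(α * ψ q)) = 1 := by rw [hE, ← Real.exp_add]; simp
      nlinarith
    have h4 : -⟪ν, q⟫ ≤ ε * (E - 1) := by nlinarith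
    have h5 : ε * (E - 1) ≤ θ * ψ q := by
      have := mul_le_mul_of_nonneg_left h1 hε.le
      rw [hθ]; linarith
    have h6 : θ * ψ q ≤ k * ⟪f, q⟫ := by gcongr
    linarith
  set a := -(2 * A * Q q * y₀) with ha
  set b := 1 - 2 * A * Q q * (1 - x₀) with hb
  set u : E3 := a • p + b • f with hu
  have hum : u = f - (2 * A * Q q) • m := by
    rw [hu, hm, ha, hb]; module
  have hy1 : ⟪f, q⟫ < 1 := hy.trans hy₀1
  obtain ⟨hN1, hN2⟩ := barrier_gradient_bounds hx₀ hy₀ hA (hQy.trans hy1) ha hb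
  have hm5 : ‖m‖ ^ 2 ≤ 5 := by
    rw [hF.norm_sq m, hm]
    simp only [inner_add_right, real_inner_smul_right, hF.self_u, hF.self_v, hF.uv,
      real_inner_comm p f, real_inner_comm p ν, real_inner_comm f ν, hF.uw, hF.vw]
    nlinarith only [hx₀, hx₀n]
  have hNpos : 0 < a ^ 2 + b ^ 2 := by
    have : 0 < y₀ ^ 2 := by positivity
    linarith
  have hα2 : 160 * A < α * (a ^ 2 + b ^ 2) := by
    have := mul_le_mul_of_nonneg_left hN1 hα0.le
    linarith
  have hθ1 : θ ^ 2 * (a ^ 2 + b ^ 2) ≤ 1 := by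
    have h1 : θ ^ 2 * (a ^ 2 + b ^ 2) ≤ k ^ 2 * (1 + 6 * A) ^ 2 :=
      mul_le_mul (pow_le_pow_left₀ hθ0.le hθk 2) hN2 hNpos.le (by positivity)
    rw [← mul_pow] at h1
    exact h1.trans (pow_le_one₀ (by positivity) hε1)
  refine no_touch_graph hW hsmooth hmean horth hF hm5 hQ hψ hu hum hNpos (by linarith) hα0 hα2 hε
    hθ hθ1 hq (fun h1 => ?_) hqt hloc
  have hs := hF.norm_sq q
  rw [h1, one_pow] at hs
  have hmq : ⟪m, q⟫ = y₀ * ⟪p, q⟫ + (1 - x₀) * ⟪f, q⟫ := by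
    rw [hm, inner_add_left, real_inner_smul_left, real_inner_smul_left]
  have hsign := barrier_boundary_sign hx₀ hd hy0 hy hs.symm hzk hk0.le hε2 (by linarith)
    (Q := Q q) (by rw [hQ, hmq]; ring) hA1 hA2 hQy
  have huq : ⟪q, u⟫ = ⟪f, q⟫ - 2 * A * Q q * (Q q + y₀) := by
    rw [real_inner_comm, hum, inner_sub_left, real_inner_smul_left, hQ]; ring
  rw [inner_add_right, real_inner_smul_right, huq, real_inner_comm]
  have := mul_neg_of_pos_of_neg hθ0 hsign
  linarith

/-! ### The half-disk and the complement below it -/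

variable {p f ν : E3}

/-- The part of the ball below the plane `ν⊥` and outside of `W`, with its limit points. -/
def below (W : Set E3) (ν : E3) : Set E3 :=
  closure {x | x ∈ closedBall (0 : E3) 1 ∧ ⟪ν, x⟫ < 0 ∧ x ∉ W}

theorem below_subset_closure_diff : below W ν ⊆ closure (closedBall (0 : E3) 1 \ W) :=
  closure_mono fun _ hx => ⟨hx.1, hx.2.2⟩

theorem below_subset_closedBall : below W ν ⊆ closedBall (0 : E3) 1 :=
  closure_minimal (fun _ hx => hx.1) isClosed_closedBall

theorem inner_nonpos_of_mem_below {x : E3} (hx : x ∈ below W ν) : ⟪ν, x⟫ ≤ 0 := by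
  have hc : IsClosed {y : E3 | ⟪ν, y⟫ ≤ 0} := isClosed_le (by fun_prop) continuous_const
  exact closure_minimal (fun y hy => hy.2.1.le) hc hx

theorem mem_of_notMem_below {x : E3} (hx : x ∉ below W ν) (hB : x ∈ closedBall (0 : E3) 1)
    (h : ⟪ν, x⟫ < 0) : x ∈ W := by
  by_contra hW
  exact hx (subset_closure ⟨hB, h, hW⟩)

theorem isCompact_below : IsCompact (below W ν) :=
  (isCompact_closedBall (0 : E3) 1).of_isClosed_subset isClosed_closure below_subset_closedBall

theorem Frame.mem_closedHalfDisk (hF : Frame p f ν) {x : E3} :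
    x ∈ closedHalfDisk p f ↔ ‖x‖ ≤ 1 ∧ 0 ≤ ⟪f, x⟫ ∧ ⟪ν, x⟫ = 0 := by
  constructor
  · rintro ⟨hx, a, b, hb, rfl⟩
    refine ⟨by simpa using hx, ?_, ?_⟩
    · rw [inner_add_right, real_inner_smul_right, real_inner_smul_right, hF.self_v,
        real_inner_comm, hF.uv]
      simpa using hb
    · rw [inner_add_right, real_inner_smul_right, real_inner_smul_right, real_inner_comm, hF.uw,
        real_inner_comm, hF.vw]
      simp
  · rintro ⟨hx, hy, hz⟩
    refine ⟨by simpa using hx, ⟪p, x⟫, ⟪f, x⟫, hy, ?_⟩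
    conv_lhs => rw [hF.expand x, hz, zero_smul, add_zero]

theorem tendsto_ray (q u : E3) : Tendsto (fun t : ℝ => q + t • u) (𝓝[>] 0) (𝓝 q) := by
  have : ContinuousAt (fun t : ℝ => q + t • u) 0 := by fun_prop
  have := this.tendsto
  simp only [zero_smul, add_zero] at this
  exact this.mono_left nhdsWithin_le_nhds

/-- Strict increase of a defining function in a cone of directions around `ν`. -/
theorem IsDefiningFunction.exists_cone {U : Set E3} {ρ : E3 → ℝ} (h : IsDefiningFunction W U ρ)
    {q : E3} (hq : q ∈ U) {l : ℝ} (hl : 0 < l) (hg : gradient ρ q = l • ν) {C : ℝ} (hC : 0 < C) :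
    ∃ δ > 0, ball q δ ⊆ U ∧ ∀ x ∈ ball q δ, ∀ y ∈ ball q δ, ‖x - y‖ ≤ C * ⟪ν, x - y⟫ →
      ρ y + l / (2 * C) * ‖x - y‖ ≤ ρ x := by
  have hs := (h.hasStrictFDerivAt hq).isLittleO.def (c := l / (2 * C)) (by positivity)
  rw [nhds_prod_eq, (nhds_basis_ball.prod_self).eventually_iff] at hs
  obtain ⟨δ₁, hδ₁, h1⟩ := hs
  obtain ⟨δ₂, hδ₂, h2⟩ := Metric.isOpen_iff.1 h.isOpen q hq
  refine ⟨min δ₁ δ₂, lt_min hδ₁ hδ₂, (ball_subset_ball (min_le_right _ _)).trans h2, ?_⟩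
  intro x hx y hy hxy
  have := h1 (show (x, y) ∈ ball q δ₁ ×ˢ ball q δ₁ from
    ⟨ball_subset_ball (min_le_left _ _) hx, ball_subset_ball (min_le_left _ _) hy⟩)
  simp only [innerSL_apply_apply, hg, real_inner_smul_left, Real.norm_eq_abs] at this
  have h3 := (abs_le.1 this).1
  have h4 : l / C * ‖x - y‖ ≤ l * ⟪ν, x - y⟫ := by
    rw [div_mul_eq_mul_div, div_le_iff₀ hC]
    have := mul_le_mul_of_nonneg_left hxy hl.le
    linarith
  have h5 : l / C = l / (2 * C) + l / (2 * C) := by field_simp; norm_num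
  rw [h5] at h4
  linarith

/-- At a point of a half-disk contained in `W` where it touches `∂W`, away from the diameter,
the gradient is normal to the half-disk. -/
theorem gradient_eq_of_touch (hW : IsClosedRegion W) (horth : MeetsSphereOrthogonally W)
    (hF : Frame p f ν) (hD : closedHalfDisk p f ⊆ W) {q : E3} (hq : q ∈ closedHalfDisk p f)
    (hy : 0 < ⟪f, q⟫) (hqb : q ∈ bdry W) {U : Set E3} {ρ : E3 → ℝ} (hqU : q ∈ U)
    (hρ : IsDefiningFunction W U ρ) : gradient ρ q = ⟪ν, gradient ρ q⟫ • ν := by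
  have hρ0 := hρ.eq_zero hW hqb hqU
  obtain ⟨hq1, -, hqz⟩ := hF.mem_closedHalfDisk.1 hq
  set n := gradient ρ q with hn
  have hdir : ∀ u : E3, ⟪ν, u⟫ = 0 → (‖q‖ = 1 → ⟪q, u⟫ < 0) → 0 ≤ ⟪n, u⟫ := by
    intro u hu huq
    refine inner_gradient_nonneg (hρ.hasFDerivAt hqU) hρ0 ?_
    have hfy : ∀ᶠ x in 𝓝 q, 0 < ⟪f, x⟫ := by
      have : ContinuousAt (fun x : E3 => ⟪f, x⟫) q := by fun_prop
      exact this.eventually (lt_mem_nhds hy)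
    filter_upwards [eventually_mem_closedBall hq1 huq, (tendsto_ray q u).eventually hfy,
      (tendsto_ray q u).eventually (hρ.isOpen.mem_nhds hqU)] with t h1 h2 h3
    refine hρ.nonneg h3 (hD (hF.mem_closedHalfDisk.2 ⟨by simpa using h1, h2.le, ?_⟩))
    rw [inner_add_right, real_inner_smul_right, hu, hqz]; ring
  -- On the sphere only directions entering the ball are available, but a multiple of `q` can be
  -- subtracted freely since `n ⟂ q`.
  have hdir2 : ∀ v : E3, ⟪ν, v⟫ = 0 → 0 ≤ ⟪n, v⟫ := by
    intro v hv
    rcases hq1.lt_or_eq with hlt | heq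
    · exact hdir v hv fun h => absurd h hlt.ne
    · have hnq : ⟪n, q⟫ = 0 := horth U ρ hρ q ⟨hqb, hqU⟩ (by simpa using heq)
      have := hdir (v - (⟪q, v⟫ + 1) • q)
        (by rw [inner_sub_right, real_inner_smul_right, hv, hqz]; ring)
        (fun _ => by
          rw [inner_sub_right, real_inner_smul_right, real_inner_self_eq_norm_sq, heq]
          linarith)
      rw [inner_sub_right, real_inner_smul_right, hnq] at this
      linarith
  have hzero : ∀ v : E3, ⟪ν, v⟫ = 0 → ⟪v, n⟫ = 0 := by
    intro v hv
    have h1 := hdir2 v hv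
    have h2 := hdir2 (-v) (by rw [inner_neg_right, hv, neg_zero])
    rw [inner_neg_right] at h2
    rw [real_inner_comm]
    linarith
  conv_lhs => rw [hF.expand n, hzero p (by rw [real_inner_comm]; exact hF.uw),
    hzero f (by rw [real_inner_comm]; exact hF.vw)]
  simp

/-- The vertical projection to the plane `ν⊥`. -/
theorem Frame.proj_props (hF : Frame p f ν) (x : E3) :
    ⟪p, x - ⟪ν, x⟫ • ν⟫ = ⟪p, x⟫ ∧ ⟪f, x - ⟪ν, x⟫ • ν⟫ = ⟪f, x⟫ ∧ ⟪ν, x - ⟪ν, x⟫ • ν⟫ = 0 ∧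
      ‖x - ⟪ν, x⟫ • ν‖ ≤ ‖x‖ := by
  have h1 : ⟪p, x - ⟪ν, x⟫ • ν⟫ = ⟪p, x⟫ := by
    rw [inner_sub_right, real_inner_smul_right, hF.uw]; ring
  have h2 : ⟪f, x - ⟪ν, x⟫ • ν⟫ = ⟪f, x⟫ := by
    rw [inner_sub_right, real_inner_smul_right, hF.vw]; ring
  have h3 : ⟪ν, x - ⟪ν, x⟫ • ν⟫ = 0 := by
    rw [inner_sub_right, real_inner_smul_right, hF.self_w]; ring
  refine ⟨h1, h2, h3, ?_⟩
  have e1 := hF.norm_sq (x - ⟪ν, x⟫ • ν)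
  have e2 := hF.norm_sq x
  rw [h1, h2, h3] at e1
  exact (sq_le_sq₀ (norm_nonneg _) (norm_nonneg _)).1 (by linarith [sq_nonneg ⟪ν, x⟫])

/-- If points below the half-disk outside `W` accumulate at `q`, then `W` lies above at `q`. -/
theorem inner_gradient_pos_of_mem_below (hW : IsClosedRegion W)
    (horth : MeetsSphereOrthogonally W)
    (hF : Frame p f ν) (hD : closedHalfDisk p f ⊆ W) {q : E3} (hq : q ∈ closedHalfDisk p f)
    (hy : 0 < ⟪f, q⟫) (hqb : q ∈ below W ν) {U : Set E3} {ρ : E3 → ℝ} (hqU : q ∈ U)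
    (hρ : IsDefiningFunction W U ρ) : 0 < ⟪ν, gradient ρ q⟫ := by
  have hqb' := hW.mem_bdry (hD hq) (below_subset_closure_diff hqb)
  have hg := gradient_eq_of_touch hW horth hF hD hq hy hqb' hqU hρ
  obtain ⟨hq1, -, hqz⟩ := hF.mem_closedHalfDisk.1 hq
  by_contra! hle
  rcases hle.lt_or_eq with hlt | h0
  swap
  · rw [h0, zero_smul] at hg
    exact hρ.gradient_ne_zero q hqU hg
  -- With a downward gradient, `ρ` would increase from the half-disk downwards, putting the nearby
  -- points below it in `W`.
  obtain ⟨δ, hδ, hδU, hcone⟩ := hρ.exists_cone (ν := -ν) hqU (neg_pos.2 hlt)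
    (by rw [smul_neg, neg_smul, neg_neg]; exact hg) one_pos
  have hfy : ∀ᶠ x in 𝓝 q, 0 < ⟪f, x⟫ := by
    have : ContinuousAt (fun x : E3 => ⟪f, x⟫) q := by fun_prop
    exact this.eventually (lt_mem_nhds hy)
  have hpr : ∀ᶠ x in 𝓝 q, x - ⟪ν, x⟫ • ν ∈ ball q δ := by
    have : ContinuousAt (fun x : E3 => x - ⟪ν, x⟫ • ν) q := by fun_prop
    exact this.eventually (isOpen_ball.mem_nhds (by simpa [hqz] using hδ))
  obtain ⟨x, ⟨hxB, hxz, hxW⟩, ⟨hx1, hx2⟩, hx3⟩ := (mem_closure_iff_frequently.1 hqb).and_eventually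
    ((hfy.and hpr).and (ball_mem_nhds q hδ)) |>.exists
  obtain ⟨-, h2, h3, h4⟩ := hF.proj_props x
  have hmem : x - ⟪ν, x⟫ • ν ∈ W := hD (hF.mem_closedHalfDisk.2
    ⟨h4.trans (by simpa using hxB), by rw [h2]; exact hx1.le, h3⟩)
  have e : x - (x - ⟪ν, x⟫ • ν) = ⟪ν, x⟫ • ν := by abel
  have hc := hcone x hx3 _ hx2 (by
    rw [e, norm_smul, hF.norm_w, real_inner_smul_right, inner_neg_left, hF.self_w,
      Real.norm_eq_abs, abs_of_neg hxz]
    linarith)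
  have h5 := hρ.nonneg (hδU hx2) hmem
  refine hxW (hρ.mem (hδU hx3) hxB ?_)
  have : 0 ≤ -⟪ν, gradient ρ q⟫ / (2 * 1) * ‖x - (x - ⟪ν, x⟫ • ν)‖ :=
    mul_nonneg (by linarith) (norm_nonneg _)
  linarith

/-- In the situation of `inner_gradient_pos_of_mem_below`, points above belong to `W`. -/
theorem eventually_mem_of_mem_below (hW : IsClosedRegion W) (hsmooth : HasSmoothBdry W)
    (horth : MeetsSphereOrthogonally W)
    (hF : Frame p f ν) (hD : closedHalfDisk p f ⊆ W) {q : E3} (hq : q ∈ closedHalfDisk p f)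
    (hy : 0 < ⟪f, q⟫) (hqb : q ∈ below W ν) :
    ∀ᶠ x in 𝓝 q, x ∈ closedBall (0 : E3) 1 → 0 ≤ ⟪ν, x⟫ → x ∈ W := by
  have hqb' := hW.mem_bdry (hD hq) (below_subset_closure_diff hqb)
  obtain ⟨U, ρ, hqU, hρ⟩ := hsmooth q hqb'
  have hg := gradient_eq_of_touch hW horth hF hD hq hy hqb' hqU hρ
  have hl := inner_gradient_pos_of_mem_below hW horth hF hD hq hy hqb hqU hρ
  obtain ⟨hq1, -, hqz⟩ := hF.mem_closedHalfDisk.1 hq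
  obtain ⟨δ, hδ, hδU, hcone⟩ := hρ.exists_cone hqU hl hg one_pos
  have hfy : ∀ᶠ x in 𝓝 q, 0 < ⟪f, x⟫ := by
    have : ContinuousAt (fun x : E3 => ⟪f, x⟫) q := by fun_prop
    exact this.eventually (lt_mem_nhds hy)
  have hpr : ∀ᶠ x in 𝓝 q, x - ⟪ν, x⟫ • ν ∈ ball q δ := by
    have : ContinuousAt (fun x : E3 => x - ⟪ν, x⟫ • ν) q := by fun_prop
    exact this.eventually (isOpen_ball.mem_nhds (by simpa [hqz] using hδ))
  filter_upwards [hfy, hpr, ball_mem_nhds q hδ] with x hx1 hx2 hx3 hxB hxz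
  obtain ⟨-, h2, h3, h4⟩ := hF.proj_props x
  have hmem : x - ⟪ν, x⟫ • ν ∈ W := hD (hF.mem_closedHalfDisk.2
    ⟨h4.trans (by simpa using hxB), by rw [h2]; exact hx1.le, h3⟩)
  have e : x - (x - ⟪ν, x⟫ • ν) = ⟪ν, x⟫ • ν := by abel
  have hc := hcone x hx3 _ hx2 (by
    rw [e, norm_smul, hF.norm_w, real_inner_smul_right, hF.self_w, Real.norm_eq_abs,
      abs_of_nonneg hxz]
    linarith)
  have h5 := hρ.nonneg (hδU hx2) hmem
  refine hρ.mem (hδU hx3) hxB ?_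
  have : 0 ≤ ⟪ν, gradient ρ q⟫ / (2 * 1) * ‖x - (x - ⟪ν, x⟫ • ν)‖ := by positivity
  linarith

/-! ### The Hopf argument at the corner -/

/-- The order of choice matters: `A` from the geometry, one summand per condition, then `α` from
`A`, then `ε` small against both. -/
theorem exists_barrier_parameters {y₀ d r : ℝ} (hy : 0 < y₀) (hd : 0 < d) (hr : 0 < r) :
    ∃ A α ε : ℝ, 1 ≤ A ∧ 16 ≤ A * y₀ ^ 2 * d ^ 2 ∧ 2 < A * y₀ * d ∧ 4 ≤ A * y₀ ^ 2 * r ^ 2 ∧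
      0 < α ∧ α * y₀ ^ 2 = 2000 * A ∧ 0 < ε ∧ ε * Real.exp α * α * (1 + 6 * A) ≤ 1 ∧
      ε * Real.exp α * α ≤ d / 2 ∧ ε * Real.exp α ≤ r / 2 := by
  set A := 16 / (y₀ ^ 2 * d ^ 2) + 4 / (y₀ ^ 2 * r ^ 2) + 2 / (y₀ * d) + 1 with hA
  have p1 : 0 < 16 / (y₀ ^ 2 * d ^ 2) := by positivity
  have p2 : 0 < 4 / (y₀ ^ 2 * r ^ 2) := by positivity
  have p3 : 0 < 2 / (y₀ * d) := by positivity
  have hA0 : 0 < A := by positivity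
  set α := 2000 * A / y₀ ^ 2 with hα
  have hα0 : 0 < α := by positivity
  set c := min (1 / (α * (1 + 6 * A))) (min (d / (2 * α)) (r / 2)) with hc
  have hc0 : 0 < c := lt_min (by positivity) (lt_min (by positivity) (by positivity))
  have hce : c / Real.exp α * Real.exp α = c := div_mul_cancel₀ _ (Real.exp_pos _).ne'
  have c1 : c ≤ 1 / (α * (1 + 6 * A)) := min_le_left _ _
  have c2 : c ≤ d / (2 * α) := (min_le_right _ _).trans (min_le_left _ _)
  have c3 : c ≤ r / 2 := (min_le_right _ _).trans (min_le_right _ _)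
  refine ⟨A, α, c / Real.exp α, by linarith, ?_, ?_, ?_, hα0, ?_, by positivity, ?_, ?_, ?_⟩
  · have : 16 / (y₀ ^ 2 * d ^ 2) ≤ A := by linarith
    rw [div_le_iff₀ (by positivity)] at this
    linarith
  · have : 2 / (y₀ * d) < A := by linarith
    rw [div_lt_iff₀ (by positivity)] at this
    linarith
  · have : 4 / (y₀ ^ 2 * r ^ 2) ≤ A := by linarith
    rw [div_le_iff₀ (by positivity)] at this
    linarith
  · rw [hα, div_mul_cancel₀ _ (by positivity)]
  · rw [hce]
    rw [le_div_iff₀ (by positivity)] at c1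
    linarith
  · rw [hce]
    rw [le_div_iff₀ (by positivity)] at c2
    linarith
  · rw [hce]; exact c3

/-- The region below the half-disk and above the graph of the barrier lies in `W`. -/
theorem barrier_nonpos (hW : IsClosedRegion W) (hsmooth : HasSmoothBdry W)
    (hmean : HasMeanConvexBdry W) (horth : MeetsSphereOrthogonally W)
    (hF : Frame p f ν) (hD : closedHalfDisk p f ⊆ W) {q₀ m : E3} {y₀ d r A α ε : ℝ}
    {Q ψ : E3 → ℝ} (hq₀ : ⟪p, q₀⟫ ^ 2 + y₀ ^ 2 < 1) (hqy : ⟪f, q₀⟫ = y₀) (hqz : ⟪ν, q₀⟫ = 0)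
    (hr : 0 < r) (hrW : ball q₀ r ⊆ (below W ν)ᶜ)
    (hd : d = 1 - ⟪p, q₀⟫ ^ 2 - y₀ ^ 2) (hm : m = y₀ • p + (1 - ⟪p, q₀⟫) • f)
    (hQ : ∀ x, Q x = ⟪m, x⟫ - y₀) (hψ : ∀ x, ψ x = ⟪f, x⟫ - A * Q x ^ 2)
    (hA : 1 ≤ A) (hA1 : 16 ≤ A * y₀ ^ 2 * d ^ 2) (hA2 : 2 < A * y₀ * d)
    (hA3 : 4 ≤ A * y₀ ^ 2 * r ^ 2) (hα0 : 0 < α)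
    (hα : α * y₀ ^ 2 = 2000 * A) (hε : 0 < ε) (hε1 : ε * Real.exp α * α * (1 + 6 * A) ≤ 1)
    (hε2 : ε * Real.exp α * α ≤ d / 2) (hε3 : ε * Real.exp α ≤ r / 2)
    {x : E3} (hx : x ∈ below W ν) (hx0 : 0 ≤ ⟪f, x⟫) (hxy : ⟪f, x⟫ ≤ y₀) :
    ⟪ν, x⟫ + ε * (Real.exp (α * ψ x) - 1) ≤ 0 := by
  have hy₀1 : y₀ < 1 := by nlinarith only [sq_nonneg ⟪p, q₀⟫, hq₀]
  have hψc : Continuous ψ := by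
    have : ψ = fun x => ⟪f, x⟫ - A * (⟪m, x⟫ - y₀) ^ 2 := by
      funext x; rw [hψ, hQ]
    rw [this]; fun_prop
  have hfc : Continuous fun x : E3 => ⟪f, x⟫ := by fun_prop
  have hM : IsCompact (below W ν ∩ ((fun x : E3 => ⟪f, x⟫) ⁻¹' Icc 0 y₀)) :=
    isCompact_below.inter_right (isClosed_Icc.preimage hfc)
  have hτc : Continuous fun x => ⟪ν, x⟫ + ε * (Real.exp (α * ψ x) - 1) := by fun_prop
  by_contra! hpos
  obtain ⟨q, ⟨hqb, hq0, hqy₀⟩, hmax⟩ := hM.exists_isMaxOn ⟨x, hx, hx0, hxy⟩ hτc.continuousOn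
  have hqpos : 0 < ⟪ν, q⟫ + ε * (Real.exp (α * ψ q) - 1) :=
    lt_of_lt_of_le hpos (hmax ⟨hx, hx0, hxy⟩)
  simp only at hq0 hqy₀
  set t := (⟪ν, q⟫ + ε * (Real.exp (α * ψ q) - 1)) / ε with ht
  have ht0 : 0 < t := div_pos hqpos hε
  have htε : ε * t = ⟪ν, q⟫ + ε * (Real.exp (α * ψ q) - 1) := mul_div_cancel₀ _ hε.ne'
  have hqz' : ⟪ν, q⟫ ≤ 0 := inner_nonpos_of_mem_below hqb
  have hE1 : 1 < Real.exp (α * ψ q) := by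
    by_contra! h
    have := mul_nonneg hε.le (sub_nonneg.2 h)
    linarith
  have hψ0 : 0 < ψ q := by
    have := Real.one_lt_exp_iff.1 hE1
    exact pos_of_mul_pos_right this hα0.le
  have hQy : A * Q q ^ 2 < ⟪f, q⟫ := by have := hψ q; linarith
  have hAQ0 : 0 ≤ A * Q q ^ 2 := mul_nonneg (by linarith) (sq_nonneg _)
  have hy0 : 0 < ⟪f, q⟫ := by linarith
  have hmq : ⟪m, q⟫ = y₀ * ⟪p, q⟫ + (1 - ⟪p, q₀⟫) * ⟪f, q⟫ := by
    rw [hm, inner_add_left, real_inner_smul_left, real_inner_smul_left]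
  -- On the edge `y = y₀` the parabola and the smallness of `ε` confine `q` to the ball about `q₀`,
  -- where `below W ν` has no points.
  have hylt : ⟪f, q⟫ < y₀ := by
    refine lt_of_le_of_ne hqy₀ fun heq => ?_
    refine hrW (mem_ball_iff_norm.2 ?_) hqb
    have hn := hF.norm_sq (q - q₀)
    simp only [inner_sub_right, heq, hqy, hqz, sub_self, sub_zero] at hn
    have hQq : Q q = y₀ * (⟪p, q⟫ - ⟪p, q₀⟫) := by rw [hQ, hmq, heq]; ring
    have h1 : (⟪p, q⟫ - ⟪p, q₀⟫) ^ 2 < r ^ 2 / 4 := by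
      have h2 : A * y₀ ^ 2 * (⟪p, q⟫ - ⟪p, q₀⟫) ^ 2 < 1 := by
        have : A * y₀ ^ 2 * (⟪p, q⟫ - ⟪p, q₀⟫) ^ 2 = A * Q q ^ 2 := by rw [hQq]; ring
        linarith
      have hA0 : 0 < A * y₀ ^ 2 := by
        have : 0 < y₀ ^ 2 := by rw [← heq]; positivity
        positivity
      refine lt_of_mul_lt_mul_left ?_ hA0.le
      linarith
    have h3 : ⟪ν, q⟫ ^ 2 ≤ (r / 2) ^ 2 := by
      have hle : Real.exp (α * ψ q) ≤ Real.exp α := by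
        refine Real.exp_le_exp.2 ?_
        have : ψ q ≤ 1 := by have := hψ q; linarith
        have := mul_le_mul_of_nonneg_left this hα0.le
        linarith
      have := mul_le_mul_of_nonneg_left hle hε.le
      refine sq_le_sq' ?_ ?_ <;> linarith
    have h4 : ‖q - q₀‖ ^ 2 < r ^ 2 := by rw [hn]; linarith [sq_nonneg r, pow_pos hr 2]
    exact lt_of_pow_lt_pow_left₀ 2 hr.le h4
  refine no_contact_graph hW hsmooth hmean horth hF hq₀ hd hm hQ hψ hA hA1 hA2 hα hε hε1 hε2
    (below_subset_closure_diff hqb) hy0 hylt ht0 hqz' (t := t) (by linarith) ?_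
  have hstrip : ∀ᶠ x in 𝓝 q, 0 < ⟪f, x⟫ ∧ ⟪f, x⟫ < y₀ :=
    (hfc.continuousAt.eventually (lt_mem_nhds hy0)).and
      (hfc.continuousAt.eventually (gt_mem_nhds hylt))
  -- By maximality, points of the strip above the graph through `q` are not in `below W ν`.
  have hneg : ∀ᶠ x in 𝓝 q, x ∈ closedBall (0 : E3) 1 →
      0 < ⟪ν, x⟫ + ε * (Real.exp (α * ψ x) - 1 - t) → ⟪ν, x⟫ < 0 → x ∈ W := by
    filter_upwards [hstrip] with x hx hxB hxp hxz
    refine mem_of_notMem_below (fun hxb => ?_) hxB hxz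
    have := isMaxOn_iff.1 hmax x ⟨hxb, hx.1.le, hx.2.le⟩
    linarith
  rcases hqz'.lt_or_eq with hlt | heq
  · have hνc : Continuous fun x : E3 => ⟪ν, x⟫ := by fun_prop
    filter_upwards [hneg, hνc.continuousAt.eventually (gt_mem_nhds hlt)] with x h1 h2 h3 h4
    exact h1 h3 h4 h2
  · have hqD : q ∈ closedHalfDisk p f := hF.mem_closedHalfDisk.2
      ⟨by simpa using below_subset_closedBall hqb, hy0.le, heq⟩
    filter_upwards [hneg, eventually_mem_of_mem_below hW hsmooth horth hF hD hqD hy0 hqb]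
      with x h1 h2 h3 h4
    rcases lt_or_ge ⟪ν, x⟫ 0 with h | h
    · exact h1 h3 h4 h
    · exact h2 h3 h

/-- An inner point of the half-disk is a limit of points below it outside of `W`. -/
theorem mem_below_of_tangent (hW : IsClosedRegion W) (hsmooth : HasSmoothBdry W)
    (hmean : HasMeanConvexBdry W) (horth : MeetsSphereOrthogonally W)
    (hF : Frame p f ν) (hD : closedHalfDisk p f ⊆ W) (hp : p ∈ bdry W) {U : Set E3} {ρ : E3 → ℝ}
    (hpU : p ∈ U) (hρ : IsDefiningFunction W U ρ) {l : ℝ} (hl : 0 < l)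
    (hg : gradient ρ p = l • ν) {q₀ : E3} (hq : ‖q₀‖ < 1) (hy : 0 < ⟪f, q₀⟫)
    (hz : ⟪ν, q₀⟫ = 0) : q₀ ∈ below W ν := by
  by_contra hcon
  obtain ⟨r, hr, hrW⟩ := Metric.isOpen_iff.1 (isClosed_closure (s := {x | x ∈ closedBall (0 : E3) 1 ∧
    ⟪ν, x⟫ < 0 ∧ x ∉ W})).isOpen_compl q₀ hcon
  have hn := hF.norm_sq q₀
  rw [hz] at hn
  have hq1 : ⟪p, q₀⟫ ^ 2 + ⟪f, q₀⟫ ^ 2 < 1 := by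
    have := pow_lt_one₀ (norm_nonneg q₀) hq two_ne_zero
    linarith
  set y₀ := ⟪f, q₀⟫ with hy₀
  set x₀ := ⟪p, q₀⟫ with hx₀
  obtain ⟨A, α, ε, hA, hA1, hA2, hA3, hα0, hα, hε, hε1, hε2, hε3⟩ :=
    exists_barrier_parameters (d := 1 - x₀ ^ 2 - y₀ ^ 2) hy (by linarith) hr
  have key := fun x hx hx0 hxy => barrier_nonpos hW hsmooth hmean horth hF hD (q₀ := q₀) (y₀ := y₀)
    (Q := fun x => ⟪y₀ • p + (1 - x₀) • f, x⟫ - y₀)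
    (ψ := fun x => ⟪f, x⟫ - A * (⟪y₀ • p + (1 - x₀) • f, x⟫ - y₀) ^ 2)
    hq1 rfl hz hr hrW rfl rfl (fun _ => rfl) (fun _ => rfl) hA hA1 hA2 hA3 hα0 hα hε hε1 hε2 hε3
    (x := x) hx hx0 hxy
  have hρ0 : ρ p = 0 := hρ.eq_zero hW hp hpU
  -- Along `γ` the graph drops by at least `α ε s / 4`, while `γ` drops only by `σ s ≤ α ε s / 8`;
  -- so `γ` stays above the graph.
  set σ := min (1 / 2) (α * ε / 8) with hσ
  have hσ0 : 0 < σ := lt_min (by norm_num) (by positivity)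
  have hσ1 : σ ≤ 1 / 2 := min_le_left _ _
  have hσ2 : σ ≤ α * ε / 8 := min_le_right _ _
  set w : E3 := (1 / 2 : ℝ) • f - σ • ν with hw
  -- The correction `-s² p` offsets the growth of the norm along the tangent direction `w` and keeps
  -- the curve in the ball.
  set γ : ℝ → E3 := fun s => p + s • w + (s ^ 2) • (-p) with hγ
  have hγ0 : γ 0 = p := by simp [hγ]
  have hγd : HasDerivAt γ w 0 := by
    have h1 := ((hasDerivAt_id (0 : ℝ)).smul_const w).const_add p
    have h2 := (hasDerivAt_pow 2 (0 : ℝ)).smul_const (-p)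
    have h3 := h1.add h2
    simp only [one_smul, Nat.cast_ofNat, Nat.add_one_sub_one, pow_one, mul_zero, zero_smul,
      add_zero] at h3
    exact h3
  have hfp : ⟪f, p⟫ = 0 := by rw [real_inner_comm]; exact hF.uv
  have hνp : ⟪ν, p⟫ = 0 := by rw [real_inner_comm]; exact hF.uw
  have hνf : ⟪ν, f⟫ = 0 := by rw [real_inner_comm]; exact hF.vw
  have c1 : ∀ s, ⟪p, γ s⟫ = 1 - s ^ 2 := by
    intro s
    simp only [hγ, hw, inner_add_right, inner_sub_right, inner_neg_right, real_inner_smul_right,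
      hF.self_u, hF.uv, hF.uw]
    ring
  have c2 : ∀ s, ⟪f, γ s⟫ = s / 2 := by
    intro s
    simp only [hγ, hw, inner_add_right, inner_sub_right, inner_neg_right, real_inner_smul_right,
      hF.self_v, hfp, hF.vw]
    ring
  have c3 : ∀ s, ⟪ν, γ s⟫ = -(σ * s) := by
    intro s
    simp only [hγ, hw, inner_add_right, inner_sub_right, inner_neg_right, real_inner_smul_right,
      hF.self_w, hνp, hνf]
    ring
  have hev : ∀ᶠ s in 𝓝[>] (0 : ℝ), γ s ∈ W := by
    have hb : 0 < min (min 1 (2 * y₀)) (1 / (16 * A)) := by positivity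
    filter_upwards [Ioo_mem_nhdsGT hb] with s hs
    have hs0 := hs.1
    have hs1 : s < 1 := hs.2.trans_le ((min_le_left _ _).trans (min_le_left _ _))
    have hs2 : s < 2 * y₀ := hs.2.trans_le ((min_le_left _ _).trans (min_le_right _ _))
    have hs3 : s * (16 * A) < 1 := by
      rw [← lt_div_iff₀ (by positivity)]; exact hs.2.trans_le (min_le_right _ _)
    have hss : s ^ 2 ≤ s := by rw [sq]; exact mul_le_of_le_one_left hs0.le hs1.le
    have hB : γ s ∈ closedBall (0 : E3) 1 := by
      rw [mem_closedBall_zero_iff]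
      have h1 := hF.norm_sq (γ s)
      rw [c1, c2, c3] at h1
      have h2 : σ ^ 2 ≤ 1 / 4 := by
        have := pow_le_pow_left₀ hσ0.le hσ1 2
        linarith
      have h3 := mul_le_mul_of_nonneg_right h2 (sq_nonneg s)
      have h4 : s ^ 2 * s ^ 2 ≤ s ^ 2 * 1 :=
        mul_le_mul_of_nonneg_left (by linarith) (sq_nonneg s)
      have h5 : ‖γ s‖ ^ 2 ≤ 1 := by
        rw [h1]; linarith [sq_nonneg s]
      exact (sq_le_one_iff₀ (norm_nonneg _)).1 h5
    refine mem_of_notMem_below (fun hb => ?_) hB (by rw [c3]; linarith [mul_pos hσ0 hs0])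
    have hk := key (γ s) hb (by rw [c2]; linarith) (by rw [c2]; linarith)
    simp only [inner_add_left, real_inner_smul_left, c1, c2, c3] at hk
    have hx1 : x₀ < 1 := by nlinarith only [hq1, sq_nonneg y₀]
    have hx2 : -1 < x₀ := by nlinarith only [hq1, sq_nonneg y₀]
    have hy1 : y₀ < 1 := by nlinarith only [hq1, sq_nonneg x₀]
    have hQ : (y₀ * (1 - s ^ 2) + (1 - x₀) * (s / 2) - y₀) ^ 2 ≤ (2 * s) ^ 2 := by
      have e1 : y₀ * s ^ 2 ≤ 1 * s ^ 2 := mul_le_mul_of_nonneg_right hy1.le (sq_nonneg s)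
      have e2 : (1 - x₀) * (s / 2) ≤ 2 * (s / 2) :=
        mul_le_mul_of_nonneg_right (by linarith) (by linarith)
      have e3 : 0 ≤ (1 - x₀) * (s / 2) := mul_nonneg (by linarith) (by linarith)
      have e4 : 0 ≤ y₀ * s ^ 2 := by positivity
      refine sq_le_sq' ?_ ?_ <;> linarith
    have hQ2 := mul_le_mul_of_nonneg_left hQ (by linarith : 0 ≤ A)
    have hQ3 : A * (2 * s) ^ 2 ≤ s / 4 := by
      have := mul_le_mul_of_nonneg_left hs3.le hs0.le
      linarith
    set X := s / 2 - A * (y₀ * (1 - s ^ 2) + (1 - x₀) * (s / 2) - y₀) ^ 2 with hX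
    have hX1 : s / 4 ≤ X := by rw [hX]; linarith
    have h1 := Real.add_one_le_exp (α * X)
    have h2 := mul_le_mul_of_nonneg_left hX1 hα0.le
    have h3 : ε * (α * (s / 4)) ≤ ε * (Real.exp (α * X) - 1) :=
      mul_le_mul_of_nonneg_left (by linarith) hε.le
    have h4 := mul_le_mul_of_nonneg_right hσ2 hs0.le
    have h5 : 0 < ε * α * s := by positivity
    linarith
  have hd' : HasFDerivAt ρ (innerSL ℝ (gradient ρ p)) (γ 0) := by
    rw [hγ0]; exact hρ.hasFDerivAt hpU
  have hcd := hd'.comp_hasDerivAt (0 : ℝ) hγd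
  have hγt : Tendsto γ (𝓝[>] 0) (𝓝 p) := by
    have := hγd.continuousAt.tendsto
    rw [hγ0] at this
    exact this.mono_left nhdsWithin_le_nhds
  have hnn := deriv_nonneg_of_eventually hcd (by simp only [Function.comp_apply, hγ0]; exact hρ0)
    (by filter_upwards [hev, hγt.eventually (hρ.isOpen.mem_nhds hpU)] with s h1 h2
        exact hρ.nonneg h2 h1)
  rw [innerSL_apply_apply, hg, hw, real_inner_smul_left, inner_sub_right, real_inner_smul_right,
    real_inner_smul_right, hνf, hF.self_w] at hnn
  have := mul_pos hl hσ0
  linarith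

/-- A half-disk contained in `W` and tangent to `∂W` at its corner `p` is touched from below by
the complement of `W` at each of its points. -/
theorem closedHalfDisk_subset_below (hW : IsClosedRegion W) (hsmooth : HasSmoothBdry W)
    (hmean : HasMeanConvexBdry W) (horth : MeetsSphereOrthogonally W)
    (hF : Frame p f ν) (hD : closedHalfDisk p f ⊆ W) (hp : p ∈ bdry W) {U : Set E3} {ρ : E3 → ℝ}
    (hpU : p ∈ U) (hρ : IsDefiningFunction W U ρ) {l : ℝ} (hl : 0 < l)
    (hg : gradient ρ p = l • ν) : closedHalfDisk p f ⊆ below W ν := by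
  intro q hq
  obtain ⟨hq1, hq2, hq3⟩ := hF.mem_closedHalfDisk.1 hq
  -- Weight `s / 2` instead of `s` makes the norm less than `1` while `⟨f, γ s⟩ > 0`, so
  -- `mem_below_of_tangent` applies.
  set γ : ℝ → E3 := fun s => (1 - s) • q + (s / 2) • f with hγ
  have hc : Tendsto γ (𝓝[>] 0) (𝓝 q) := by
    have : ContinuousAt γ 0 := by fun_prop
    have := this.tendsto
    simp only [hγ, sub_zero, one_smul, zero_div, zero_smul, add_zero] at this
    exact this.mono_left nhdsWithin_le_nhds
  refine isClosed_closure.mem_of_tendsto hc ?_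
  filter_upwards [Ioo_mem_nhdsGT (zero_lt_one' ℝ)] with s hs
  refine mem_below_of_tangent hW hsmooth hmean horth hF hD hp hpU hρ hl hg ?_ ?_ ?_
  · refine (norm_add_le _ _).trans_lt ?_
    rw [norm_smul, norm_smul, hF.norm_v, Real.norm_of_nonneg (by linarith [hs.2]),
      Real.norm_of_nonneg (by linarith [hs.1])]
    have := mul_le_mul_of_nonneg_left hq1 (by linarith [hs.2] : 0 ≤ 1 - s)
    linarith [hs.1]
  · rw [hγ, inner_add_right, real_inner_smul_right, real_inner_smul_right, hF.self_v]
    have := mul_nonneg (by linarith [hs.2] : 0 ≤ 1 - s) hq2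
    linarith [hs.1]
  · rw [hγ, inner_add_right, real_inner_smul_right, real_inner_smul_right, hq3, real_inner_comm,
      hF.vw]
    ring

/-! ### Wedges around the half-disk -/

/-- The gradient of a defining function along a half-disk contained in `∂W`. -/
theorem gradient_on_closedHalfDisk (hW : IsClosedRegion W)
    (horth : MeetsSphereOrthogonally W) (hF : Frame p f ν) (hD : closedHalfDisk p f ⊆ W)
    (hb : closedHalfDisk p f ⊆ below W ν) {q : E3} (hq : q ∈ closedHalfDisk p f) {U : Set E3}
    {ρ : E3 → ℝ} (hqU : q ∈ U) (hρ : IsDefiningFunction W U ρ) :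
    ∃ l : ℝ, 0 < l ∧ gradient ρ q = l • ν := by
  obtain ⟨hq1, hq2, hq3⟩ := hF.mem_closedHalfDisk.1 hq
  set γ : ℝ → E3 := fun s => (1 - s) • q + s • f with hγ
  have hc : Tendsto γ (𝓝[>] 0) (𝓝 q) := by
    have : ContinuousAt γ 0 := by fun_prop
    have := this.tendsto
    simp only [hγ, sub_zero, one_smul, zero_smul, add_zero] at this
    exact this.mono_left nhdsWithin_le_nhds
  have hgc : Tendsto (fun s => gradient ρ (γ s)) (𝓝[>] 0) (𝓝 (gradient ρ q)) :=
    (hρ.gradient_differentiableAt hqU).continuousAt.tendsto.comp hc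
  have hev : ∀ᶠ s in 𝓝[>] (0 : ℝ), gradient ρ (γ s) = ⟪ν, gradient ρ (γ s)⟫ • ν ∧
      0 ≤ ⟪ν, gradient ρ (γ s)⟫ := by
    filter_upwards [Ioo_mem_nhdsGT (zero_lt_one' ℝ), hc.eventually (hρ.isOpen.mem_nhds hqU)]
      with s hs hsU
    have hy : 0 < ⟪f, γ s⟫ := by
      rw [hγ, inner_add_right, real_inner_smul_right, real_inner_smul_right, hF.self_v]
      have := mul_nonneg (by linarith [hs.2] : 0 ≤ 1 - s) hq2
      linarith [hs.1]
    have hmem : γ s ∈ closedHalfDisk p f := by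
      refine hF.mem_closedHalfDisk.2 ⟨?_, hy.le, ?_⟩
      · refine (norm_add_le _ _).trans ?_
        rw [norm_smul, norm_smul, hF.norm_v, Real.norm_of_nonneg (by linarith [hs.2]),
          Real.norm_of_nonneg (by linarith [hs.1])]
        have := mul_le_mul_of_nonneg_left hq1 (by linarith [hs.2] : 0 ≤ 1 - s)
        linarith
      · rw [hγ, inner_add_right, real_inner_smul_right, real_inner_smul_right, hq3,
          real_inner_comm, hF.vw]
        ring
    have hbd := hW.mem_bdry (hD hmem) (below_subset_closure_diff (hb hmem))
    exact ⟨gradient_eq_of_touch hW horth hF hD hmem hy hbd hsU hρ,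
      (inner_gradient_pos_of_mem_below hW horth hF hD hmem hy (hb hmem) hsU hρ).le⟩
  have hin : Tendsto (fun s => ⟪ν, gradient ρ (γ s)⟫) (𝓝[>] 0) (𝓝 ⟪ν, gradient ρ q⟫) :=
    tendsto_const_nhds.inner hgc
  have h1 : gradient ρ q = ⟪ν, gradient ρ q⟫ • ν :=
    tendsto_nhds_unique_of_eventuallyEq hgc (hin.smul_const ν) (hev.mono fun _ h => h.1)
  have h2 : 0 ≤ ⟪ν, gradient ρ q⟫ := ge_of_tendsto hin (hev.mono fun _ h => h.2)
  refine ⟨⟪ν, gradient ρ q⟫, lt_of_le_of_ne h2 fun h0 => ?_, h1⟩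
  rw [← h0, zero_smul] at h1
  exact hρ.gradient_ne_zero q hqU h1

/-- The nearest point of the half-plane spanned by the half-disk. -/
noncomputable def halfPlaneProj (p f : E3) (x : E3) : E3 :=
  ⟪p, x⟫ • p + (max ⟪f, x⟫ 0) • f

theorem continuous_halfPlaneProj : Continuous (halfPlaneProj p f) := by
  unfold halfPlaneProj; fun_prop

theorem Frame.halfPlaneProj_mem (hF : Frame p f ν) {x : E3} (hx : ‖x‖ ≤ 1) :
    halfPlaneProj p f x ∈ closedHalfDisk p f := by
  refine ⟨?_, _, _, le_max_right _ _, rfl⟩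
  have hfp : ⟪f, p⟫ = 0 := by rw [real_inner_comm]; exact hF.uv
  have hνp : ⟪ν, p⟫ = 0 := by rw [real_inner_comm]; exact hF.uw
  have hνf : ⟪ν, f⟫ = 0 := by rw [real_inner_comm]; exact hF.vw
  have h1 := hF.norm_sq (halfPlaneProj p f x)
  simp only [halfPlaneProj, inner_add_right, real_inner_smul_right, hF.self_u, hF.self_v, hF.uv,
    hfp, hνp, hνf] at h1
  have h2 := hF.norm_sq x
  have h3 : (max ⟪f, x⟫ 0) ^ 2 ≤ ⟪f, x⟫ ^ 2 := by
    rcases max_cases ⟪f, x⟫ 0 with ⟨h, _⟩ | ⟨h, _⟩ <;> rw [h]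
    nlinarith [sq_nonneg ⟪f, x⟫]
  rw [mem_closedBall_zero_iff, ← sq_le_one_iff₀ (norm_nonneg _)]
  have h4 := (sq_le_one_iff₀ (norm_nonneg x)).2 hx
  have h5 := sq_nonneg ⟪ν, x⟫
  rw [halfPlaneProj]
  linarith

theorem Frame.halfPlaneProj_self (hF : Frame p f ν) {x : E3} (hx : x ∈ closedHalfDisk p f) :
    halfPlaneProj p f x = x := by
  obtain ⟨-, h2, h3⟩ := hF.mem_closedHalfDisk.1 hx
  conv_rhs => rw [hF.expand x, h3, zero_smul, add_zero]
  rw [halfPlaneProj, max_eq_left h2]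

theorem Frame.sub_halfPlaneProj (hF : Frame p f ν) (x : E3) :
    x - halfPlaneProj p f x = (min ⟪f, x⟫ 0) • f + ⟪ν, x⟫ • ν := by
  conv_lhs => enter [1]; rw [hF.expand x]
  have : ⟪f, x⟫ = max ⟪f, x⟫ 0 + min ⟪f, x⟫ 0 := by rw [max_add_min]; ring
  rw [halfPlaneProj]
  nth_rewrite 1 [this]
  module

/-- Near a half-disk contained in `∂W`, the region `W` contains a wedge-shaped neighbourhood. -/
theorem eventually_mem_of_wedge (hW : IsClosedRegion W) (hsmooth : HasSmoothBdry W)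
    (horth : MeetsSphereOrthogonally W) (hF : Frame p f ν) (hD : closedHalfDisk p f ⊆ W)
    (hb : closedHalfDisk p f ⊆ below W ν) {q : E3} (hq : q ∈ closedHalfDisk p f) {κ : ℝ}
    (hκ : 0 < κ) : ∀ᶠ x in 𝓝 q, x ∈ closedBall (0 : E3) 1 → 0 < ⟪ν, x⟫ →
      -(κ * ⟪f, x⟫) < ⟪ν, x⟫ → x ∈ W := by
  obtain ⟨U, ρ, hqU, hρ⟩ := hsmooth q (hW.mem_bdry (hD hq) (below_subset_closure_diff (hb hq)))
  obtain ⟨l, hl, hg⟩ := gradient_on_closedHalfDisk hW horth hF hD hb hq hqU hρ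
  -- In the wedge the distance to the half-plane is at most `z + z / κ`.
  obtain ⟨δ, hδ, hδU, hcone⟩ := hρ.exists_cone hqU hl hg (C := 1 + 1 / κ) (by positivity)
  have hpr : ∀ᶠ x in 𝓝 q, halfPlaneProj p f x ∈ ball q δ :=
    (continuous_halfPlaneProj (p := p) (f := f)).continuousAt.eventually
      (isOpen_ball.mem_nhds (by rw [hF.halfPlaneProj_self hq]; exact mem_ball_self hδ))
  filter_upwards [hpr, ball_mem_nhds q hδ] with x hx1 hx2 hxB hxz hxκ
  have hmem := hD (hF.halfPlaneProj_mem (x := x) (by simpa using hxB))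
  have hνf : ⟪ν, f⟫ = 0 := by rw [real_inner_comm]; exact hF.vw
  have hc := hcone x hx2 _ hx1 (by
    rw [hF.sub_halfPlaneProj, inner_add_right, real_inner_smul_right, real_inner_smul_right, hνf,
      hF.self_w]
    refine (norm_add_le _ _).trans ?_
    rw [norm_smul, norm_smul, hF.norm_v, hF.norm_w, Real.norm_eq_abs, Real.norm_eq_abs,
      abs_of_pos hxz, abs_of_nonpos (min_le_right _ _)]
    have h1 : -(min ⟪f, x⟫ 0) ≤ 1 / κ * ⟪ν, x⟫ := by
      rw [one_div_mul_eq_div, le_div_iff₀ hκ]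
      rcases min_cases ⟪f, x⟫ 0 with ⟨h, _⟩ | ⟨h, _⟩ <;> rw [h] <;> linarith
    linarith)
  have h5 := hρ.nonneg (hδU hx1) hmem
  refine hρ.mem (hδU hx2) hxB ?_
  have : 0 ≤ l / (2 * (1 + 1 / κ)) * ‖x - halfPlaneProj p f x‖ := by positivity
  linarith

theorem Frame.isCompact_closedHalfDisk (hF : Frame p f ν) : IsCompact (closedHalfDisk p f) := by
  have : closedHalfDisk p f = closedBall (0 : E3) 1 ∩ ({x | 0 ≤ ⟪f, x⟫} ∩ {x | ⟪ν, x⟫ = 0}) := by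
    ext x
    rw [hF.mem_closedHalfDisk, mem_inter_iff, mem_closedBall_zero_iff]
    rfl
  rw [this]
  exact (isCompact_closedBall _ _).inter_right ((isClosed_le continuous_const (by fun_prop)).inter
    (isClosed_eq (by fun_prop) continuous_const))

/-- Compactness of the half-disk makes the wedge uniform along it, corners included. -/
theorem exists_wedge (hW : IsClosedRegion W) (hsmooth : HasSmoothBdry W)
    (horth : MeetsSphereOrthogonally W) (hF : Frame p f ν) (hD : closedHalfDisk p f ⊆ W)
    (hb : closedHalfDisk p f ⊆ below W ν) {κ : ℝ} (hκ : 0 < κ) :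
    ∃ r > 0, ∀ x ∈ closedBall (0 : E3) 1, 0 < ⟪ν, x⟫ → ⟪ν, x⟫ < r → -r < ⟪f, x⟫ →
      -(κ * ⟪f, x⟫) < ⟪ν, x⟫ → x ∈ W := by
  have hsub : closedHalfDisk p f ⊆ interior {x | x ∈ closedBall (0 : E3) 1 → 0 < ⟪ν, x⟫ →
      -(κ * ⟪f, x⟫) < ⟪ν, x⟫ → x ∈ W} := fun q hq =>
    mem_interior_iff_mem_nhds.2 (eventually_mem_of_wedge hW hsmooth horth hF hD hb hq hκ)
  obtain ⟨δ, hδ, hth⟩ := hF.isCompact_closedHalfDisk.exists_thickening_subset_open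
    isOpen_interior hsub
  refine ⟨δ / 2, by positivity, fun x hxB hz hzr hy hκy => ?_⟩
  refine interior_subset (hth ?_) hxB hz hκy
  refine mem_thickening_iff.2 ⟨_, hF.halfPlaneProj_mem (x := x) (by simpa using hxB), ?_⟩
  rw [dist_eq_norm, hF.sub_halfPlaneProj]
  refine (norm_add_le _ _).trans_lt ?_
  rw [norm_smul, norm_smul, hF.norm_v, hF.norm_w, Real.norm_eq_abs, Real.norm_eq_abs,
    abs_of_pos hz, abs_of_nonpos (min_le_right _ _)]
  rcases min_cases ⟪f, x⟫ 0 with ⟨h, _⟩ | ⟨h, _⟩ <;> rw [h] <;> linarith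

/-! ### Sweeping the upper half-ball -/

/-- Sweeping out by spherical caps: if the half-disk lies in `∂W`, with `W` above it, then `W`
contains the open half ball above it. -/
theorem upper_half_subset (hW : IsClosedRegion W) (hsmooth : HasSmoothBdry W)
    (hmean : HasMeanConvexBdry W)
    (horth : MeetsSphereOrthogonally W) (hF : Frame p f ν) (hD : closedHalfDisk p f ⊆ W)
    (hb : closedHalfDisk p f ⊆ below W ν) {w : E3} (hw : w ∈ closedBall (0 : E3) 1)
    (hwz : 0 < ⟪ν, w⟫) : w ∈ W := by
  by_contra hwW
  have hcoord : ∀ x ∈ closedBall (0 : E3) 1, ⟪ν, x⟫ ≤ 1 ∧ -1 ≤ ⟪f, x⟫ := by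
    intro x hx
    have hx' : ‖x‖ ≤ 1 := by simpa using hx
    have h1 := abs_le.1 (abs_real_inner_le_norm ν x)
    have h2 := abs_le.1 (abs_real_inner_le_norm f x)
    rw [hF.norm_w, one_mul] at h1
    rw [hF.norm_v, one_mul] at h2
    constructor <;> linarith [h1.2, h2.1]
  -- The factor `8` leaves `⟨ν, w⟩ - κ b ≥ 7 κ`, which bounds the slope `c` of the extremal cap from
  -- below.
  set κ := ⟪ν, w⟫ / 8 with hκ
  have hκ0 : 0 < κ := by positivity
  have hw1 := (hcoord w hw).1
  obtain ⟨r, hr, hwedge⟩ := exists_wedge hW hsmooth horth hF hD hb hκ0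
  set b := min 1 (r / 2) with hbdef
  have hb0 : 0 < b := lt_min one_pos (by positivity)
  have hb1 : b ≤ 1 := min_le_left _ _
  have hbr : b ≤ r / 2 := min_le_right _ _
  have hκb : 0 < κ * b := mul_pos hκ0 hb0
  have hκb1 : κ * b ≤ κ := mul_le_of_le_one_right hκ0.le hb1
  have hκbr : κ * b ≤ 1 / 8 * b := mul_le_mul_of_nonneg_right (by linarith) hb0.le
  set N := closure (closedBall (0 : E3) 1 \ W) with hN
  have hNB : N ⊆ closedBall (0 : E3) 1 := closure_minimal sdiff_subset isClosed_closedBall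
  have hνc : Continuous fun x : E3 => ⟪ν, x⟫ := by fun_prop
  have hfc : Continuous fun x : E3 => ⟪f, x⟫ := by fun_prop
  have hNw : ∀ x ∈ N, 0 < ⟪ν, x⟫ → ⟪ν, x⟫ < r → -r < ⟪f, x⟫ →
      -(κ * ⟪f, x⟫) < ⟪ν, x⟫ → False := by
    intro x hx h1 h2 h3 h4
    have hO : IsOpen {y : E3 | 0 < ⟪ν, y⟫ ∧ ⟪ν, y⟫ < r ∧ -r < ⟪f, y⟫ ∧
        -(κ * ⟪f, y⟫) < ⟪ν, y⟫} := by
      refine (isOpen_lt continuous_const hνc).inter ((isOpen_lt hνc continuous_const).inter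
        ((isOpen_lt continuous_const hfc).inter (isOpen_lt (by fun_prop) hνc)))
    obtain ⟨y, ⟨g1, g2, g3, g4⟩, hyB, hyW⟩ := mem_closure_iff.1 hx _ hO ⟨h1, h2, h3, h4⟩
    exact hyW (hwedge y hyB g1 g2 g3 g4)
  set K := N ∩ (fun x : E3 => ⟪ν, x⟫) ⁻¹' Ici (2 * (κ * b)) with hK
  have hKc : IsCompact K := ((isCompact_closedBall (0 : E3) 1).of_isClosed_subset isClosed_closure
    hNB).inter_right (isClosed_Ici.preimage hνc)
  have hwK : w ∈ K := ⟨subset_closure ⟨hw, hwW⟩, by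
    change 2 * (κ * b) ≤ ⟪ν, w⟫
    linarith⟩
  -- The caps `num = c (z - κ b)` are pieces of large spheres. They meet the unit sphere in planes
  -- through the line `y = -b`, `z = κ b`, a displaced copy of the diameter. The term in `‖x‖ ^ 2`
  -- makes the curvature strict.
  set num : E3 → ℝ := fun x => ⟪f, x⟫ + b + b / 8 * (‖x‖ ^ 2 - 1) with hnum
  have hnumc : Continuous num := by rw [hnum]; fun_prop
  have hden : ∀ x ∈ K, 0 < ⟪ν, x⟫ - κ * b := by
    intro x hx
    have : 2 * (κ * b) ≤ ⟪ν, x⟫ := hx.2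
    linarith
  have hτc : ContinuousOn (fun x => num x / (⟪ν, x⟫ - κ * b)) K :=
    hnumc.continuousOn.div (by fun_prop) fun x hx => (hden x hx).ne'
  obtain ⟨q, hqK, hmax⟩ := hKc.exists_isMaxOn ⟨w, hwK⟩ hτc
  set c := num q / (⟪ν, q⟫ - κ * b) with hc
  have hcq : c * (⟪ν, q⟫ - κ * b) = num q := div_mul_cancel₀ _ (hden q hqK).ne'
  have hle : ∀ x ∈ K, num x ≤ c * (⟪ν, x⟫ - κ * b) := by
    intro x hx
    have := isMaxOn_iff.1 hmax x hx
    rwa [div_le_iff₀ (hden x hx)] at this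
  have hcκ : -1 ≤ 2 * (c * κ) := by
    have h1 := hle w hwK
    have h2 : -1 ≤ num w := by
      have := (hcoord w hw).2
      have h3 : 0 ≤ b / 8 * ‖w‖ ^ 2 := by positivity
      simp only [hnum]
      linarith
    by_contra! hneg
    have h3 : 0 ≤ ⟪ν, w⟫ - κ * b - 7 * κ := by linarith
    have hc0 : c < 0 := by
      by_contra! h
      linarith [mul_nonneg h hκ0.le]
    have h4 := mul_nonneg_of_nonpos_of_nonpos hc0.le (neg_nonpos.2 h3)
    linarith
  have hnq : ‖q‖ ≤ 1 := by simpa using hNB hqK.1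
  -- On the bottom face `z = 2 κ b` the bound on `c κ` gives `y ≥ -3 b / 2`, which lies in the wedge
  -- already contained in `W`.
  have hqz : 2 * (κ * b) < ⟪ν, q⟫ := by
    refine lt_of_le_of_ne hqK.2 fun heq => ?_
    have hnum_le : num q ≤ ⟪f, q⟫ + b := by
      have : ‖q‖ ^ 2 ≤ 1 := pow_le_one₀ (norm_nonneg _) hnq
      have := mul_nonneg (by positivity : 0 ≤ b / 8) (sub_nonneg.2 this)
      simp only [hnum]
      linarith
    have h1 : -(b / 2) ≤ num q := by
      rw [← hcq, ← heq]
      have := mul_le_mul_of_nonneg_right hcκ hb0.le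
      linarith
    have h2 : -(3 / 2 * b) ≤ ⟪f, q⟫ := by linarith
    refine hNw q hqK.1 ?_ ?_ ?_ ?_
    · rw [← heq]; linarith
    · rw [← heq]; linarith
    · linarith
    · rw [← heq]
      have := mul_le_mul_of_nonneg_left h2 hκ0.le
      linarith
  set g : E3 := f - c • ν + (b / 4) • q with hg
  have hg0 : g ≠ 0 := by
    intro h
    have h1 : ⟪f, g⟫ = 0 := by rw [h, inner_zero_right]
    rw [hg, inner_add_right, inner_sub_right, real_inner_smul_right, real_inner_smul_right,
      hF.self_v, hF.vw] at h1
    have h2 := mul_le_mul_of_nonneg_left (hcoord q (hNB hqK.1)).2 (by positivity : 0 ≤ b / 4)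
    linarith
  obtain ⟨v₁, v₂, hFr⟩ := exists_orthonormal_pair g hg0
  refine no_touch hW hsmooth hmean horth (B := fun h => b / 8 * ‖h‖ ^ 2) hqK.1 hg0 hFr (by fun_prop)
    (fun t h => by rw [norm_smul, mul_pow, Real.norm_eq_abs, sq_abs]; ring)
    (by rw [hFr.norm_u, hFr.norm_v]; linarith) (fun h1 => ?_) ?_
  -- On the sphere `⟨q, g⟩ = -3 b / 4 - c κ b ≤ -b / 4`.
  · rw [hg, inner_add_right, inner_sub_right, real_inner_smul_right, real_inner_smul_right,
      real_inner_self_eq_norm_sq, h1, real_inner_comm, real_inner_comm ν q]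
    have h2 : num q = ⟪f, q⟫ + b := by simp only [hnum, h1]; ring
    have h3 := mul_le_mul_of_nonneg_right hcκ hb0.le
    rw [h2] at hcq
    linarith
  · filter_upwards [hνc.continuousAt.eventually (lt_mem_nhds hqz)] with x hx hxB hpos
    by_contra hxW
    have h1 := hle x ⟨subset_closure ⟨hxB, hxW⟩, hx.le⟩
    have h2 : num x = num q + c * (⟪ν, x⟫ - ⟪ν, q⟫) + (⟪g, x - q⟫ + b / 8 * ‖x - q‖ ^ 2) := by
      have e : ‖x‖ ^ 2 = ‖q‖ ^ 2 + 2 * ⟪q, x - q⟫ + ‖x - q‖ ^ 2 := by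
        rw [← norm_add_sq_real]; congr 2; abel
      simp only [hnum, hg, inner_add_left, inner_sub_left, real_inner_smul_left, e]
      rw [inner_sub_right f, inner_sub_right ν]
      ring
    rw [h2, ← hcq] at h1
    linarith

/-! ### The lower half and the conclusion -/

theorem closedHalfDisk_neg_left (e f : E3) : closedHalfDisk (-e) f = closedHalfDisk e f := by
  ext x
  constructor <;> rintro ⟨hx, a, b, hb, rfl⟩ <;> exact ⟨hx, -a, b, hb, by simp⟩

/-- Near an equatorial disk contained in `∂W` from below, `W` lies above the disk. -/
theorem eventually_inner_nonneg (hW : IsClosedRegion W) (hsmooth : HasSmoothBdry W)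
    (horth : MeetsSphereOrthogonally W) (hF : Frame p f ν)
    (hD : closedHalfDisk p f ⊆ W) (hb : closedHalfDisk p f ⊆ below W ν)
    (hb' : closedHalfDisk p (-f) ⊆ below W ν) (hD' : closedHalfDisk p (-f) ⊆ W) {q : E3}
    (hq : q ∈ closedHalfDisk p f) : ∀ᶠ x in 𝓝 q, x ∈ W → 0 ≤ ⟪ν, x⟫ := by
  obtain ⟨U, ρ, hqU, hρ⟩ := hsmooth q (hW.mem_bdry (hD hq) (below_subset_closure_diff (hb hq)))
  obtain ⟨l, hl, hg⟩ := gradient_on_closedHalfDisk hW horth hF hD hb hq hqU hρ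
  obtain ⟨hq1, -, hqz⟩ := hF.mem_closedHalfDisk.1 hq
  obtain ⟨δ, hδ, hδU, hcone⟩ := hρ.exists_cone hqU hl hg one_pos
  have hpr : ∀ᶠ x in 𝓝 q, x - ⟪ν, x⟫ • ν ∈ ball q δ := by
    have : ContinuousAt (fun x : E3 => x - ⟪ν, x⟫ • ν) q := by fun_prop
    exact this.eventually (isOpen_ball.mem_nhds (by simpa [hqz] using hδ))
  filter_upwards [hpr, ball_mem_nhds q hδ] with x hx1 hx2 hxW
  by_contra! hneg
  obtain ⟨-, h2, h3, h4⟩ := hF.proj_props x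
  have hx : ‖x‖ ≤ 1 := by simpa using hW.subset_ball hxW
  -- The projection lies in one of the two half-disks, so `ρ` vanishes there and is strictly smaller
  -- at the lower point `x`.
  have hbd : x - ⟪ν, x⟫ • ν ∈ bdry W := by
    rcases le_total 0 ⟪f, x⟫ with h | h
    · have hm := hF.mem_closedHalfDisk.2 ⟨h4.trans hx, h2.symm ▸ h, h3⟩
      exact hW.mem_bdry (hD hm) (below_subset_closure_diff (hb hm))
    · have hm := hF.neg_v.mem_closedHalfDisk.2
        ⟨h4.trans hx, by rw [inner_neg_left, h2]; linarith, h3⟩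
      exact hW.mem_bdry (hD' hm) (below_subset_closure_diff (hb' hm))
  have h0 := hρ.eq_zero hW hbd (hδU hx1)
  have e : x - ⟪ν, x⟫ • ν - x = (-⟪ν, x⟫) • ν := by module
  have hn : ‖x - ⟪ν, x⟫ • ν - x‖ = -⟪ν, x⟫ := by
    rw [e, norm_smul, hF.norm_w, mul_one, Real.norm_of_nonneg (by linarith)]
  have hc := hcone _ hx1 x hx2 (by
    rw [hn, e, real_inner_smul_right, hF.self_w]; linarith)
  have h5 := hρ.nonneg (hδU hx2) hxW
  rw [hn, h0] at hc
  have : 0 < l / (2 * 1) * (-⟪ν, x⟫) := mul_pos (by positivity) (by linarith)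
  linarith

/-- A region tangent to a half-disk at a corner, with inner normal `ν` there, is a half ball. -/
theorem eq_halfBall_of_frame (hW : IsClosedRegion W) (hsmooth : HasSmoothBdry W)
    (hmean : HasMeanConvexBdry W) (horth : MeetsSphereOrthogonally W)
    (hF : Frame p f ν) (hD : closedHalfDisk p f ⊆ W) (hp : p ∈ bdry W) {U : Set E3} {ρ : E3 → ℝ}
    (hpU : p ∈ U) (hρ : IsDefiningFunction W U ρ) {l : ℝ} (hl : 0 < l)
    (hg : gradient ρ p = l • ν) : W = {x | x ∈ closedBall (0 : E3) 1 ∧ 0 ≤ ⟪ν, x⟫} := by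
  have hb := closedHalfDisk_subset_below hW hsmooth hmean horth hF hD hp hpU hρ hl hg
  have hup : ∀ x ∈ closedBall (0 : E3) 1, 0 < ⟪ν, x⟫ → x ∈ W := fun x hx hz =>
    upper_half_subset hW hsmooth hmean horth hF hD hb hx hz
  have hup' : ∀ x ∈ closedBall (0 : E3) 1, 0 ≤ ⟪ν, x⟫ → x ∈ W := by
    intro x hx hz
    have hx' : ‖x‖ ≤ 1 := by simpa using hx
    have hc : Tendsto (fun s : ℝ => (1 - s) • x + s • ν) (𝓝[>] 0) (𝓝 x) := by
      have : ContinuousAt (fun s : ℝ => (1 - s) • x + s • ν) 0 := by fun_prop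
      have := this.tendsto
      simp only [sub_zero, one_smul, zero_smul, add_zero] at this
      exact this.mono_left nhdsWithin_le_nhds
    refine hW.isClosed.mem_of_tendsto hc ?_
    filter_upwards [Ioo_mem_nhdsGT (zero_lt_one' ℝ)] with s hs
    refine hup _ ?_ ?_
    · rw [mem_closedBall_zero_iff]
      refine (norm_add_le _ _).trans ?_
      rw [norm_smul, norm_smul, hF.norm_w, Real.norm_of_nonneg (by linarith [hs.2]),
        Real.norm_of_nonneg (by linarith [hs.1])]
      have := mul_le_mul_of_nonneg_left hx' (by linarith [hs.2] : 0 ≤ 1 - s)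
      linarith
    · rw [inner_add_right, real_inner_smul_right, real_inner_smul_right, hF.self_w]
      have := mul_nonneg (by linarith [hs.2] : 0 ≤ 1 - s) hz
      linarith [hs.1]
  have hD' : closedHalfDisk p (-f) ⊆ W := fun x hx =>
    hup' x hx.1 (hF.neg_v.mem_closedHalfDisk.1 hx).2.2.ge
  -- The opposite half-disk has the same corner `p` and the same normal there, so the Hopf argument
  -- applies to it as well.
  have hb' := closedHalfDisk_subset_below hW hsmooth hmean horth hF.neg_v hD' hp hpU hρ hl hg
  have hnn : ∀ x ∈ W, 0 ≤ ⟪ν, x⟫ := by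
    have hlow : IsOpen {x : E3 | ⟪ν, x⟫ < 0} := isOpen_lt (by fun_prop) continuous_const
    intro x hxW
    by_contra! hneg
    -- Near the equatorial disk `W` lies in `z ≥ 0`, so the part of `W` with `z < 0` is separated
    -- from the rest, which contains `p`.
    obtain ⟨y, hyW, hy1, hy2⟩ := hW.connected.isPreconnected {x | ⟪ν, x⟫ < 0}
      (interior {x | x ∈ W → 0 ≤ ⟪ν, x⟫}) hlow isOpen_interior
      (by
        intro x hx
        rcases lt_trichotomy ⟪ν, x⟫ 0 with h | h | h
        · exact Or.inl h
        · right
          rw [mem_interior_iff_mem_nhds]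
          have hx' : ‖x‖ ≤ 1 := by simpa using hW.subset_ball hx
          rcases le_total 0 ⟪f, x⟫ with hf | hf
          · exact eventually_inner_nonneg hW hsmooth horth hF hD hb hb' hD'
              (hF.mem_closedHalfDisk.2 ⟨hx', hf, h⟩)
          · exact eventually_inner_nonneg hW hsmooth horth hF.neg_v hD' hb'
              (by rwa [neg_neg]) (by rwa [neg_neg])
              (hF.neg_v.mem_closedHalfDisk.2 ⟨hx', by rw [inner_neg_left]; linarith, h⟩)
        · right
          rw [mem_interior_iff_mem_nhds]
          have hc : Continuous fun x : E3 => ⟪ν, x⟫ := by fun_prop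
          filter_upwards [hc.continuousAt.eventually (lt_mem_nhds h)] with y hy _
          exact hy.le)
      ⟨x, hxW, hneg⟩
      ⟨p, hW.bdry_subset hp, by
        rw [mem_interior_iff_mem_nhds]
        exact eventually_inner_nonneg hW hsmooth horth hF hD hb hb' hD'
          (hF.mem_closedHalfDisk.2 ⟨hF.norm_u.le, by rw [real_inner_comm, hF.uv],
            by rw [real_inner_comm, hF.uw]⟩)⟩
    exact absurd (interior_subset hy2 hyW) (not_le.2 hy1)
  ext x
  exact ⟨fun hx => ⟨hW.subset_ball hx, hnn x hx⟩, fun hx => hup' x hx.1 hx.2⟩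

/-- The gradient of a defining function is orthogonal to the tangent plane of `∂W`. -/
theorem inner_gradient_eq_zero_of_mem_tangentPlane (hW : IsClosedRegion W) {U : Set E3}
    {ρ : E3 → ℝ} (hρ : IsDefiningFunction W U ρ) (hp : p ∈ bdry W) (hpU : p ∈ U) {v : E3}
    (hv : v ∈ tangentPlane (bdry W) p) : ⟪gradient ρ p, v⟫ = 0 := by
  have h1 : HasFDerivWithinAt ρ (innerSL ℝ (gradient ρ p)) (bdry W) p :=
    (hρ.hasFDerivAt hpU).hasFDerivWithinAt
  have h2 : HasFDerivWithinAt ρ (0 : E3 →L[ℝ] ℝ) (bdry W) p := by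
    refine (hasFDerivWithinAt_const (0 : ℝ) p (bdry W)).congr_of_eventuallyEq ?_
      (hρ.eq_zero hW hp hpU)
    filter_upwards [self_mem_nhdsWithin, nhdsWithin_le_nhds (hρ.isOpen.mem_nhds hpU)] with x hx hxU
    exact hρ.eq_zero hW hx hxU
  have h3 := h1.unique_on h2
  have h4 : tangentPlane (bdry W) p ≤ LinearMap.ker (innerSL ℝ (gradient ρ p)).toLinearMap := by
    refine Submodule.span_le.2 fun x hx => ?_
    simpa using h3 hx
  simpa using h4 hv

/-- The half-disk is convex, so the direction of each segment from `x` within it is in the tangent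
cone. -/
theorem sub_mem_tangentPlane_closedHalfDisk {e f x y : E3} (hx : x ∈ closedHalfDisk e f)
    (hy : y ∈ closedHalfDisk e f) : y - x ∈ tangentPlane (closedHalfDisk e f) x := by
  refine Submodule.subset_span (mem_tangentConeAt_of_segment_subset ?_)
  have hc : Convex ℝ (closedHalfDisk e f) := by
    rintro a ⟨ha, a₁, b₁, hb₁, rfl⟩ b ⟨hb, a₂, b₂, hb₂, rfl⟩ s t hs ht hst
    refine ⟨convex_closedBall _ _ ha hb hs ht hst, s * a₁ + t * a₂, s * b₁ + t * b₂, by positivity,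
      by module⟩
  exact hc.segment_subset hx hy

end FreeBoundary

theorem mainTheorem7 (W : Set FreeBoundary.E3)
    (hW : FreeBoundary.IsClosedRegion W)
    (hsmooth : FreeBoundary.HasSmoothBdry W)
    (hmean : FreeBoundary.HasMeanConvexBdry W)
    (horth : FreeBoundary.MeetsSphereOrthogonally W)
    (e f : FreeBoundary.E3) (he : ‖e‖ = 1) (hf : ‖f‖ = 1) (hef : inner ℝ e f = 0)
    (hD : FreeBoundary.closedHalfDisk e f ⊆ W)
    (p : FreeBoundary.E3) (hp : p = e ∨ p = -e)
    (htan : FreeBoundary.AreTangentAt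
      (FreeBoundary.bdry W) (FreeBoundary.closedHalfDisk e f) p) :
    FreeBoundary.IsClosedHalfBall W := by
  open FreeBoundary in
  have hpe : closedHalfDisk p f = closedHalfDisk e f := by
    rcases hp with rfl | rfl
    · rfl
    · exact closedHalfDisk_neg_left e f
  have hp1 : ‖p‖ = 1 := by rcases hp with rfl | rfl <;> simp [he]
  have hpf : ⟪p, f⟫ = 0 := by rcases hp with rfl | rfl <;> simp [hef]
  rw [← hpe] at hD htan
  obtain ⟨hpb, hpD, hplane⟩ := htan
  obtain ⟨U, ρ, hpU, hρ⟩ := hsmooth p hpb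
  have hn0 := hρ.gradient_ne_zero p hpU
  have horthog : ∀ y ∈ closedHalfDisk p f, ⟪gradient ρ p, y - p⟫ = 0 := fun y hy =>
    inner_gradient_eq_zero_of_mem_tangentPlane hW hρ hpb hpU
      (hplane ▸ sub_mem_tangentPlane_closedHalfDisk hpD hy)
  -- The chords from `p` to `-p` and to `f` span the plane of the half-disk.
  have h1 := horthog (-p) ⟨by simp [hp1], -1, 0, le_rfl, by simp⟩
  have h2 := horthog f ⟨by simp [hf], 0, 1, zero_le_one, by simp⟩
  rw [inner_sub_right, inner_neg_right] at h1
  rw [inner_sub_right] at h2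
  have hnp : ⟪gradient ρ p, p⟫ = 0 := by linarith
  have hnf : ⟪gradient ρ p, f⟫ = 0 := by linarith
  have hnn : 0 < ‖gradient ρ p‖ := norm_pos_iff.2 hn0
  have hF : Frame p f (unitNormal ρ p) := by
    refine ⟨hp1, hf, norm_smul_inv_norm (𝕜 := ℝ) hn0, hpf, ?_, ?_⟩
    · rw [unitNormal, real_inner_smul_right, real_inner_comm, hnp, mul_zero]
    · rw [unitNormal, real_inner_smul_right, real_inner_comm, hnf, mul_zero]
  refine ⟨unitNormal ρ p, hF.norm_w, eq_halfBall_of_frame hW hsmooth hmean horth hF hD hpb hpU hρ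
    hnn ?_⟩
  rw [unitNormal, smul_smul, mul_inv_cancel₀ hnn.ne', one_smul]
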